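/- Let $\hbar>0$ and let $\sigma((x,p),(x',p'))=p\cdot x'-x\cdot p'$ on $\mathbb{R}^{2n}$. For $\psi,\phi\in L^2(\mathbb{R}^n)$ put $$W(\psi,\phi)(x,p)=\left(\tfrac{1}{2\pi\hbar}\right)^n\int e^{-\frac{i}{\hbar}p\cdot y}\,\psi(x+\tfrac12 y)\,\overline{\phi(x-\tfrac12 y)}\,dy,\qquad W\psi=W(\psi,\psi),\qquad U_\phi\psi=(2\pi\hbar)^{n/2}W(\psi,\phi),$$ and $\mathcal H_\phi=U_\phi(L^2(\mathbb{R}^n))$. For functions $a,b,\Psi$ on $\mathbb{R}^{2n}$ and $\varepsilon>0$ put $$a\star_\varepsilon b(z)=\left(\tfrac{1}{\pi\varepsilon}\right)^{2n}\iint e^{-\frac{2i}{\varepsilon}\sigma(u-z,v-z)}a(u)b(v)\,du\,dv\quad\text{(integrated first in }u\text{, then in }v),$$ $$\mathrm{Op}_{\mathrm{Bopp}}(a)\Psi(z)=\left(\tfrac{1}{2\pi\hbar}\right)^{n}\int a_\sigma(z_0)\,e^{-\frac{i}{\hbar}\sigma(z,z_0)}\Psi(z-\tfrac12z_0)\,dz_0,\qquad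 a_\sigma(z)=\left(\tfrac{1}{2\pi\hbar}\right)^{n}\int e^{-\frac{i}{\hbar}\sigma(z,z')}a(z')\,dz',$$ and, for smooth $a,b$ and $r\ge0$, let $$P^r(a,b)(z)=\left.\Big(\sum_{i=1}^n\frac{\partial^2}{\partial x_i\partial p_i'}-\frac{\partial^2}{\partial x_i'\partial p_i}\Big)^{r}a(z)b(z')\right|_{z'=z}$$ be the $r$-th power of the Poisson bracket. Let $\widehat\rho=\sum_j\lambda_j\widehat\Pi_{\psi_j}$ be a density operator on $L^2(\mathbb{R}^n)$, where $(\psi_j)$ is an orthonormal family, $\widehat\Pi_{\psi_j}$ is the orthogonal projection onto $\mathbb{C}\psi_j$, $\lambda_j\ge0$ and $\sum_j\lambda_j=1$. Let $\rho=\sum_j\lambda_jW\psi_j$ be its Wigner distribution, and assume that $\rho\in\mathcal S(\mathbb{R}^{2n})$. Let $\phi,\psi\in L^2(\mathbb{R}^n)$ be such that $W(\psi,\phi)\in C^\infty(\mathbb{R}^{2n})$ (for instance $\phi\in\mathcal S(\mathbb{R}^n)$ and $\psi\in L^2(\mathbb{R}^n)$ arbitrary). Let $\widetilde\rho_\phi$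 be the restriction of $\mathrm{Op}_{\mathrm{Bopp}}((2\pi\hbar)^n\rho)$ to $\mathcal H_\phi$ and let $\Psi=U_\phi\psi$. Then $\widetilde\rho_\phi\Psi=U_\phi(\widehat\rho\psi)\in\mathcal H_\phi$, and $$\widetilde\rho_\phi\Psi=(2\pi\hbar)^{3n/2}\,\rho\star_\hbar W(\psi,\phi),$$ where the Moyal product is identified with the formal series $$\rho\star_\varepsilon W(\psi,\phi)\sim\sum_{r\ge0}\frac{1}{r!}\Big(\frac{i\varepsilon}{2}\Big)^{r}P^r(\rho,W(\psi,\phi))$$ in the deformation parameter $\varepsilon$ (the functions $\rho$ and $W(\psi,\phi)$ being kept fixed), in the following sense: for every compact $K\subset\mathbb{R}^{2n}$ and every $N\ge0$ there is $C$ such that $$\Big|\rho\star_\varepsilon W(\psi,\phi)(z)-\sum_{r<N}\frac{1}{r!}\Big(\frac{i\varepsilon}{2}\Big)^{r}P^r(\rho,W(\psi,\phi))(z)\Big|\le C\varepsilon^N\qquad(z\in K,\ 0<\varepsilon\le1).$$ Moreover $W\psi_j\in C^\infty(\mathbb{R}^{2n})$ whenever $\lambda_j\ne0$, and for every $r\ge0$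 and every $z$ $$P^r(\rho,W(\psi,\phi))(z)=\sum_j\lambda_j\,P^r(W\psi_j,W(\psi,\phi))(z),$$ the series being absolutely convergent (terms with $\lambda_j=0$ are zero). -/

import Mathlib

open scoped ContDiff

noncomputable section

namespace BoppMoyal

/-- Configuration space `ℝⁿ` with its Euclidean structure. -/
abbrev Conf (n : ℕ) := EuclideanSpace ℝ (Fin n)

/-- Phase space `ℝ²ⁿ`; a point is a pair `z = (x, p)`, and the measure is Lebesgue measure `dx dp`. -/
abbrev Phase (n : ℕ) := Conf n × Conf n

/-- The Hilbert space `L²(ℝⁿ)`. -/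
abbrev L2 (n : ℕ) := MeasureTheory.Lp ℂ 2 (MeasureTheory.volume : MeasureTheory.Measure (Conf n))

/-- The standard symplectic form `σ(z, z') = Jz · z' = p · x' - x · p'`. -/
def sympl {n : ℕ} (z z' : Phase n) : ℝ := inner ℝ z.2 z'.1 - inner ℝ z.1 z'.2

/-- The cross-Wigner transform
`W(ψ,φ)(x,p) = (2πħ)⁻ⁿ ∫ exp(-(i/ħ) p·y) ψ(x + y/2) φ*(x - y/2) dy`.
The integral converges absolutely for all `ψ, φ ∈ L²` and every `(x,p)`, it does not depend on the
representatives of `ψ` and `φ`, and it is a continuous function of `(x,p)`. -/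
def crossWigner {n : ℕ} (hbar : ℝ) (ψ φ : L2 n) : Phase n → ℂ := fun z =>
  (((1 / (2 * Real.pi * hbar)) ^ n : ℝ) : ℂ) *
    ∫ y : Conf n, Complex.exp (-(Complex.I / (hbar : ℂ)) * ((inner ℝ z.2 y : ℝ) : ℂ)) *
      ψ (z.1 + (1 / 2 : ℝ) • y) * (starRingEnd ℂ) (φ (z.1 - (1 / 2 : ℝ) • y))

/-- The wavepacket transform `U_φ ψ = (2πħ)^{n/2} W(ψ,φ)` with window `φ`. -/
def wavepacket {n : ℕ} (hbar : ℝ) (φ ψ : L2 n) : Phase n → ℂ := fun z =>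
  (((2 * Real.pi * hbar) ^ ((n : ℝ) / 2) : ℝ) : ℂ) * crossWigner hbar ψ φ z

/-- The space `H_φ = U_φ(L²(ℝⁿ))`, each element being represented by its continuous version. -/
def waveSpace {n : ℕ} (hbar : ℝ) (φ : L2 n) : Set (Phase n → ℂ) :=
  Set.range (wavepacket hbar φ)

/-- The symplectic Fourier transform
`F_σ a(z) = (2πħ)⁻ⁿ ∫ exp(-(i/ħ) σ(z,z')) a(z') dz'`. -/
def symplFourier {n : ℕ} (hbar : ℝ) (a : Phase n → ℂ) : Phase n → ℂ := fun z =>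
  (((1 / (2 * Real.pi * hbar)) ^ n : ℝ) : ℂ) *
    ∫ z' : Phase n, Complex.exp (-(Complex.I / (hbar : ℂ)) * (sympl z z' : ℂ)) * a z'

/-- The Bopp displacement operator `T̃(z₀)Ψ(z) = exp(-(i/ħ) σ(z,z₀)) Ψ(z - z₀/2)`. -/
def boppShift {n : ℕ} (hbar : ℝ) (z₀ : Phase n) (Ψ : Phase n → ℂ) : Phase n → ℂ := fun z =>
  Complex.exp (-(Complex.I / (hbar : ℂ)) * (sympl z z₀ : ℂ)) * Ψ (z - (1 / 2 : ℝ) • z₀)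

/-- The Bopp operator with symbol `a`, in its harmonic representation
`Op_Bopp(a)Ψ = (2πħ)⁻ⁿ ∫ (F_σ a)(z₀) T̃(z₀)Ψ dz₀`. -/
def boppOp {n : ℕ} (hbar : ℝ) (a Ψ : Phase n → ℂ) : Phase n → ℂ := fun z =>
  (((1 / (2 * Real.pi * hbar)) ^ n : ℝ) : ℂ) *
    ∫ z₀ : Phase n, symplFourier hbar a z₀ * boppShift hbar z₀ Ψ z

/-- The Moyal product with deformation parameter `ε`,
`(a ⋆_ε b)(z) = (πε)⁻²ⁿ ∫∫ exp(-(2i/ε) σ(u - z, v - z)) a(u) b(v) du dv`,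
as an iterated integral (both integrals converge absolutely if `a` is a Schwartz function and `b`
is bounded and measurable). -/
def moyal {n : ℕ} (ε : ℝ) (a b : Phase n → ℂ) : Phase n → ℂ := fun z =>
  (((1 / (Real.pi * ε)) ^ (2 * n) : ℝ) : ℂ) *
    ∫ v : Phase n, ∫ u : Phase n,
      Complex.exp (-(2 * Complex.I / (ε : ℂ)) * (sympl (u - z) (v - z) : ℂ)) * a u * b v

/-- The operator `ρ̂` on `L²(ℝⁿ)` is the density operator `∑ⱼ λⱼ Πⱼ`, where the `ψⱼ` are orthonormal,
`Πⱼ f = (f|ψⱼ) ψⱼ`, `λⱼ ≥ 0` and `∑ⱼ λⱼ = 1`. -/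
structure IsMixture {n : ℕ} {ι : Type*} (ρop : L2 n →L[ℂ] L2 n) (lam : ι → ℝ) (ψ : ι → L2 n) :
    Prop where
  orthonormal : Orthonormal ℂ ψ
  nonneg : ∀ j, 0 ≤ lam j
  hasSum_one : HasSum lam 1
  hasSum_apply : ∀ f : L2 n, HasSum (fun j => (lam j : ℂ) • (inner ℂ (ψ j) f : ℂ) • ψ j) (ρop f)

/-- The Wigner distribution `ρ = ∑ⱼ λⱼ W(ψⱼ,ψⱼ)` of the density operator `∑ⱼ λⱼ Πⱼ`. The series
converges absolutely and uniformly. -/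
def wignerDist {n : ℕ} {ι : Type*} (hbar : ℝ) (lam : ι → ℝ) (ψ : ι → L2 n) : Phase n → ℂ :=
  fun z => ∑' j, (lam j : ℂ) * crossWigner hbar (ψ j) (ψ j) z

/-- The Bopp phase space density operator `ρ̃_φ`: the restriction to `H_φ` of
`ρ̃ = Op_Bopp((2πħ)ⁿ ρ)`. -/
def boppDensity {n : ℕ} (hbar : ℝ) (ρ : Phase n → ℂ) (φ : L2 n) :
    waveSpace hbar φ → (Phase n → ℂ) := fun Ψ =>
  boppOp hbar (fun z => (((2 * Real.pi * hbar) ^ n : ℝ) : ℂ) * ρ z) Ψ.1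

/-- The unit vector of phase space in the direction `xᵢ`. -/
def xDir {n : ℕ} (i : Fin n) : Phase n := (EuclideanSpace.single i 1, 0)

/-- The unit vector of phase space in the direction `pᵢ`. -/
def pDir {n : ℕ} (i : Fin n) : Phase n := (0, EuclideanSpace.single i 1)

/-- The partial derivative in the direction `v` of a function of two phase space variables
`(z, z')`. -/
def partialD {n : ℕ} (v : Phase n × Phase n) (F : Phase n × Phase n → ℂ) :
    Phase n × Phase n → ℂ := fun w => fderiv ℝ F w v

/-- The operator `∑ᵢ (∂²/∂xᵢ∂p'ᵢ - ∂²/∂x'ᵢ∂pᵢ)` on functions of `(z, z') = ((x,p),(x',p'))`. -/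
def poissonOp {n : ℕ} (F : Phase n × Phase n → ℂ) : Phase n × Phase n → ℂ := fun w =>
  ∑ i : Fin n, (partialD (xDir i, 0) (partialD (0, pDir i) F) w
    - partialD (0, xDir i) (partialD (pDir i, 0) F) w)

/-- The `r`-th power of the Poisson bracket,
`Pʳ(a,b)(z) = (∑ᵢ (∂²/∂xᵢ∂p'ᵢ - ∂²/∂x'ᵢ∂pᵢ))ʳ a(z) b(z')` at `z' = z`. -/
def poissonPow {n : ℕ} (r : ℕ) (a b : Phase n → ℂ) : Phase n → ℂ := fun z =>
  (poissonOp^[r] (fun w => a w.1 * b w.2)) (z, z)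

/-- The formal power series `∑ᵣ (1/r!) (i/2)ʳ Pʳ(a,b) Xʳ` in the deformation parameter `X`, with
functions on phase space as coefficients. -/
def moyalSeries {n : ℕ} (a b : Phase n → ℂ) : PowerSeries (Phase n → ℂ) :=
  PowerSeries.mk fun r => fun z =>
    (1 / (r.factorial : ℂ)) * (Complex.I / 2) ^ r * poissonPow r a b z

/-- The family of functions `F ε`, `0 < ε ≤ 1`, is identified with the formal series `S = ∑ᵣ Sᵣ Xʳ`:
for every `N` one has `F ε = ∑_{r < N} εʳ Sᵣ + O(εᴺ)`, uniformly on compact sets. Such a series `S`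
is unique. -/
def HasFormalSeries {n : ℕ} (F : ℝ → Phase n → ℂ) (S : PowerSeries (Phase n → ℂ)) : Prop :=
  ∀ K : Set (Phase n), IsCompact K → ∀ N : ℕ, ∃ C : ℝ, ∀ ε : ℝ, 0 < ε → ε ≤ 1 → ∀ z ∈ K,
    ‖F ε z - ∑ r ∈ Finset.range N, (ε : ℂ) ^ r * PowerSeries.coeff r S z‖ ≤ C * ε ^ N

end BoppMoyal

end

open BoppMoyal

/-! Three mechanisms carry the theorem. Write `â` for the unnormalized symplectic Fourier transform
`chordFT a`.

Common form of both products. The substitution `v = z + εw` in the Moyal integral, and `z₀ = -2ħw`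
in the Bopp integral, lead to the same expression `π⁻²ⁿ ∫ exp(2iσ(z,w)) â(w) b(z + εw) dw`
(`moyal_eq`, `boppOp_eq`). In this form `ε` occurs only in the argument of `b`. For Schwartz `a` and
bounded smooth `b`, the expansion is therefore Taylor's formula for `b` at `z`: each factor of `w`
multiplying `â` is the transform of a derivative of `a`, which assembles the Poisson powers, and the
remainder is controlled by the moments of `|â|` (`hasFormalSeries_moyal`). Cross-Wigner functions
are bounded because they are matrix elements of reflections `R_z` of phase space.

Action of the density operator. Up to a constant, `W(ψ,φ)(z)` is `⟨R_z φ, ψ⟩`, and `exp(2iσ(z,w))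
W(ψ,φ)(z + ħw)` is a matrix element between `R_z φ` and a translated, modulated `ψ`. Hence the Moyal
product with `ρ` is `⟨R_z φ, Tψ⟩` for an operator `T` independent of `z`. Fourier inversion in the
momentum variable gives `T` the kernel `∑ⱼ λⱼ ψⱼ ⊗ ψⱼ*`, so that `T` is a multiple of the density
operator (`integral_chordFT_mul`, `moyal_crossWigner`).

Differentiation under the sum. No bounds on the derivatives of the individual `Wψⱼ` are given; the
smoothness of `ρ` must control them. The vectors `h(z) = (√λⱼ R_z ψⱼ)ⱼ` in the Hilbert sum have Gram
kernel `∑ⱼ λⱼ ⟨R_z ψⱼ, R_z' ψⱼ⟩`, which is a phase times `ρ̂((z - z')/ħ)` (`hasSum_inner_reflect`),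
hence smooth. A Hilbert space valued map with smooth Gram kernel is itself smooth
(`contDiff_of_gram`). Now `λⱼ Wψⱼ = Λⱼ ∘ h` and `ρ = Λ₀ ∘ h` for continuous functionals with `∑ⱼ Λⱼ
v = Λ₀ v` for every `v`. Poisson powers commute with functionals in the first argument
(`exists_poissonPow_clm`), so smoothness and the sum formula follow; unconditional summability in
`ℂ` is absolute convergence. -/

open scoped ContDiff
open MeasureTheory Filter Topology

namespace BoppMoyal

/-! ### Smoothness of Hilbert space valued maps from their Gram kernel -/

section Kernel

variable {E H : Type*} [NormedAddCommGroup E] [NormedSpace ℝ E]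
  [NormedAddCommGroup H] [InnerProductSpace ℂ H]

/-- The mixed second difference of a `C²` kernel is close to its mixed second derivative. -/
theorem mixed_difference_estimate {K : E × E → ℂ} (hK : ContDiff ℝ 2 K) (z : E) {ε : ℝ}
    (hε : 0 < ε) :
    ∃ δ > 0, ∀ v v' : E, ‖v‖ ≤ δ → ‖v'‖ ≤ δ →
      ‖K (z + v, z + v') - K (z + v, z) - K (z, z + v') + K (z, z)
        - fderiv ℝ (fderiv ℝ K) (z, z) (0, v') (v, 0)‖ ≤ ε * ‖v‖ * ‖v'‖ := by
  have h1 : ContDiff ℝ 1 (fderiv ℝ K) := hK.fderiv_right (by norm_num)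
  have dK : Differentiable ℝ K := hK.differentiable (by norm_num)
  have hst : HasStrictFDerivAt (fderiv ℝ K) (fderiv ℝ (fderiv ℝ K) (z, z)) (z, z) :=
    h1.contDiffAt.hasStrictFDerivAt (by norm_num)
  have hev := hst.isLittleO.def hε
  obtain ⟨δ, hδ, hb⟩ := Metric.eventually_nhds_iff.1 hev
  refine ⟨δ / 2, by positivity, fun v v' hv hv' => ?_⟩
  set T := fderiv ℝ (fderiv ℝ K) (z, z) with hT
  have n1 : ‖((v, 0) : E × E)‖ = ‖v‖ := by simp [Prod.norm_def]
  have n2 : ‖((0, v') : E × E)‖ = ‖v'‖ := by simp [Prod.norm_def]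
  -- The quantity bounded here is the `s`-derivative of the increment in the second variable, minus
  -- its bilinear model, along `z + s • v`. Strict differentiability bounds it uniformly, and the
  -- mean value inequality on `[0, 1]` concludes.
  have key : ∀ s ∈ Set.Icc (0 : ℝ) 1,
      ‖fderiv ℝ K (z + s • v, z + v') (v, 0) - fderiv ℝ K (z + s • v, z) (v, 0)
        - T (0, v') (v, 0)‖ ≤ ε * ‖v‖ * ‖v'‖ := by
    intro s hs
    have hsv : ‖s • v‖ < δ := by
      rw [norm_smul, Real.norm_eq_abs, abs_of_nonneg hs.1]
      nlinarith [hs.2, norm_nonneg v]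
    have := @hb ((z + s • v, z + v'), (z + s • v, z)) (by
      simp only [Prod.dist_eq, dist_self_add_left, dist_self, max_lt_iff]
      exact ⟨⟨hsv, by linarith⟩, hsv, hδ⟩)
    simp only [Prod.mk_sub_mk, sub_self, add_sub_cancel_left, n2] at this
    calc _ = ‖(fderiv ℝ K (z + s • v, z + v') - fderiv ℝ K (z + s • v, z) - T (0, v')) (v, 0)‖ := by
          simp
      _ ≤ _ := (ContinuousLinearMap.le_opNorm _ _)
      _ ≤ ε * ‖v'‖ * ‖v‖ := by rw [n1]; gcongr
      _ = _ := by ring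
  have hd : ∀ s ∈ Set.Icc (0 : ℝ) 1, HasDerivWithinAt
      (fun s : ℝ => K (z + s • v, z + v') - K (z + s • v, z) - s • T (0, v') (v, 0))
      (fderiv ℝ K (z + s • v, z + v') (v, 0) - fderiv ℝ K (z + s • v, z) (v, 0)
        - T (0, v') (v, 0)) (Set.Icc 0 1) s := by
    intro s _
    have l : ∀ y : E, HasDerivAt (fun s : ℝ => ((z + s • v, y) : E × E)) (v, 0) s := by
      intro y
      have := ((hasDerivAt_id s).smul_const v).const_add z
      simpa using this.prodMk (hasDerivAt_const s y)
    have e1 := (dK (z + s • v, z + v')).hasFDerivAt.comp_hasDerivAt s (l (z + v'))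
    have e2 := (dK (z + s • v, z)).hasFDerivAt.comp_hasDerivAt s (l z)
    refine (HasDerivAt.congr_deriv
      ((e1.sub e2).sub ((hasDerivAt_id s).smul_const (T (0, v') (v, 0)))) ?_).hasDerivWithinAt
    simp
  have := (convex_Icc (0 : ℝ) 1).norm_image_sub_le_of_norm_hasDerivWithin_le
    (C := ε * ‖v‖ * ‖v'‖) hd key (Set.left_mem_Icc.2 zero_le_one) (Set.right_mem_Icc.2 zero_le_one)
  simp only [one_smul, zero_smul, add_zero, sub_zero, norm_one, mul_one] at this
  refine le_trans (le_of_eq (congrArg norm ?_)) this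
  abel

/-- A map into a Hilbert space whose Gram kernel is `C²` is differentiable. -/
theorem differentiable_of_gram [FiniteDimensional ℝ E] [CompleteSpace H] {h : E → H}
    (hK : ContDiff ℝ 2 (fun w : E × E => (inner ℂ (h w.1) (h w.2) : ℂ))) :
    Differentiable ℝ h := by
  intro z
  set K : E × E → ℂ := fun w => (inner ℂ (h w.1) (h w.2) : ℂ) with hKdef
  let L : E → E → ℂ := fun v v' => fderiv ℝ (fderiv ℝ K) (z, z) (0, v') (v, 0)
  have hΦ : ∀ ε > 0, ∃ δ > 0, ∀ v v' : E, ‖v‖ ≤ δ → ‖v'‖ ≤ δ →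
      ‖inner ℂ (h (z + v) - h z) (h (z + v') - h z) - L v v'‖ ≤ ε * ‖v‖ * ‖v'‖ := by
    intro ε hε
    obtain ⟨δ, hδ, hb⟩ := mixed_difference_estimate hK z hε
    refine ⟨δ, hδ, fun v v' hv hv' => ?_⟩
    convert hb v v' hv hv' using 2
    simp only [inner_sub_left, inner_sub_right, L, hKdef]
    ring
  have Ladd : ∀ v v' w, L (v + v') w = L v w + L v' w := fun v v' w => by
    simp only [L]; rw [← map_add]; simp
  have Ladd' : ∀ v v' w, L w (v + v') = L w v + L w v' := fun v v' w => by
    simp only [L]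
    rw [← _root_.add_apply, ← map_add]; simp
  have Lsmul : ∀ (c : ℝ) v w, L (c • v) w = c * L v w := fun c v w => by
    simp only [L]
    rw [show ((c • v, 0) : E × E) = c • (v, 0) by simp, map_smul]; simp
  have Lsmul' : ∀ (c : ℝ) v w, L w (c • v) = c * L w v := fun c v w => by
    simp only [L]
    rw [show ((0, c • v) : E × E) = c • (0, v) by simp, map_smul]; simp
  let q : E → ℝ → H := fun v t => t⁻¹ • (h (z + t • v) - h z)
  -- Inner products of difference quotients converge as `s` and `t` tend to `0` independently; this
  -- is what makes the quotients Cauchy.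
  have hq : ∀ v v' : E, ∀ ε > 0, ∃ δ > 0, ∀ s t : ℝ, 0 < |s| → 0 < |t| → |s| < δ → |t| < δ →
      ‖inner ℂ (q v s) (q v' t) - L v v'‖ ≤ ε := by
    intro v v' ε hε
    obtain ⟨δ, hδ, hb⟩ := hΦ (ε / ((‖v‖ + 1) * (‖v'‖ + 1))) (by positivity)
    refine ⟨δ / (‖v‖ + ‖v'‖ + 1), by positivity, fun s t hs ht hsδ htδ => ?_⟩
    have bnd : ∀ (r : ℝ) (u : E), |r| < δ / (‖v‖ + ‖v'‖ + 1) → ‖u‖ ≤ ‖v‖ + ‖v'‖ + 1 →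
        ‖r • u‖ ≤ δ := by
      intro r u hr hu
      rw [norm_smul, Real.norm_eq_abs]
      calc |r| * ‖u‖ ≤ δ / (‖v‖ + ‖v'‖ + 1) * (‖v‖ + ‖v'‖ + 1) := by gcongr
        _ = δ := by field_simp
    have := hb (s • v) (t • v') (bnd s v hsδ (by linarith [norm_nonneg v']))
      (bnd t v' htδ (by linarith [norm_nonneg v]))
    rw [Lsmul, Lsmul'] at this
    have hs0 : s ≠ 0 := abs_pos.1 hs
    have ht0 : t ≠ 0 := abs_pos.1 ht
    have e : inner ℂ (q v s) (q v' t) - L v v' = ((s⁻¹ : ℝ) : ℂ) * ((t⁻¹ : ℝ) : ℂ) *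
        (inner ℂ (h (z + s • v) - h z) (h (z + t • v') - h z) - s * (t * L v v')) := by
      simp only [q, inner_smul_left_eq_smul, inner_smul_right_eq_smul, Complex.real_smul]
      push_cast
      have : (s : ℂ) ≠ 0 := by exact_mod_cast hs0
      have : (t : ℂ) ≠ 0 := by exact_mod_cast ht0
      field_simp
    rw [e, norm_mul, norm_mul, Complex.norm_real, Complex.norm_real, norm_inv, norm_inv,
      Real.norm_eq_abs, Real.norm_eq_abs]
    calc |s|⁻¹ * |t|⁻¹ * _ ≤ |s|⁻¹ * |t|⁻¹ * (ε / ((‖v‖ + 1) * (‖v'‖ + 1)) * ‖s • v‖ * ‖t • v'‖) := by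
          gcongr
      _ = ε * (‖v‖ / (‖v‖ + 1)) * (‖v'‖ / (‖v'‖ + 1)) := by
          rw [norm_smul, norm_smul, Real.norm_eq_abs, Real.norm_eq_abs]
          field_simp
      _ ≤ ε * 1 * 1 := by
          gcongr <;> (rw [div_le_one (by positivity)]; linarith)
      _ = ε := by ring
  have hcau : ∀ v, ∃ d, Tendsto (q v) (𝓝[≠] 0) (𝓝 d) := by
    intro v
    apply cauchy_map_iff_exists_tendsto.1
    rw [Metric.cauchy_iff]
    refine ⟨inferInstance, fun ε hε => ?_⟩
    obtain ⟨δ, hδ, hb⟩ := hq v v (ε ^ 2 / 8) (by positivity)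
    refine ⟨q v '' {t | 0 < |t| ∧ |t| < δ}, image_mem_map ?_, ?_⟩
    · rw [mem_nhdsWithin]
      refine ⟨Metric.ball 0 δ, Metric.isOpen_ball, by simpa, fun t ht => ?_⟩
      simpa [and_comm] using ht
    · rintro _ ⟨s, ⟨hs, hs'⟩, rfl⟩ _ ⟨t, ⟨ht, ht'⟩, rfl⟩
      rw [dist_eq_norm]
      -- The four inner products have the same limit `L v v`, which cancels with signs `+ - - +`.
      -- Four errors of `ε² / 8` give `ε² / 2`.
      have e : ((‖q v s - q v t‖ ^ 2 : ℝ) : ℂ) =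
          (inner ℂ (q v s) (q v s) - L v v) - (inner ℂ (q v s) (q v t) - L v v)
          - (inner ℂ (q v t) (q v s) - L v v) + (inner ℂ (q v t) (q v t) - L v v) := by
        have := inner_self_eq_norm_sq_to_K (𝕜 := ℂ) (q v s - q v t)
        simp only [inner_sub_left, inner_sub_right] at this
        push_cast
        rw [show ((‖q v s - q v t‖ : ℂ)) ^ 2 = _ from this.symm]
        ring
      have n : ‖q v s - q v t‖ ^ 2 ≤ ε ^ 2 / 2 := by
        have := congrArg norm e
        rw [Complex.norm_real, Real.norm_of_nonneg (by positivity)] at this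
        rw [this]
        refine (norm_add_le _ _).trans ?_
        have a1 := hb s s hs hs hs' hs'
        have a2 := hb s t hs ht hs' ht'
        have a3 := hb t s ht hs ht' hs'
        have a4 := hb t t ht ht ht' ht'
        have := norm_sub_le ((inner ℂ (q v s) (q v s) - L v v) - (inner ℂ (q v s) (q v t) - L v v))
          (inner ℂ (q v t) (q v s) - L v v)
        have := norm_sub_le (inner ℂ (q v s) (q v s) - L v v) (inner ℂ (q v s) (q v t) - L v v)
        linarith
      exact lt_of_pow_lt_pow_left₀ 2 hε.le (by nlinarith [sq_pos_of_pos hε])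
  choose D hD using hcau
  have hDD : ∀ v v', inner ℂ (D v) (D v') = L v v' := by
    intro v v'
    have t1 := (hD v).inner (𝕜 := ℂ) (hD v')
    refine tendsto_nhds_unique t1 ?_
    rw [Metric.tendsto_nhds]
    intro ε hε
    obtain ⟨δ, hδ, hb⟩ := hq v v' (ε / 2) (by positivity)
    filter_upwards [self_mem_nhdsWithin, mem_nhdsWithin_of_mem_nhds (Metric.ball_mem_nhds 0 hδ)]
      with t ht ht'
    rw [dist_eq_norm]
    have ht' : |t| < δ := by simpa using ht'
    linarith [hb t t (abs_pos.2 ht) (abs_pos.2 ht) ht' ht']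
  have zero_of : ∀ x : H, inner ℂ x x = 0 → x = 0 := fun x hx => inner_self_eq_zero.1 hx
  -- Linearity of `D` comes from its Gram matrix: by bilinearity of `L`, the defect vectors have
  -- norm zero.
  let Dl : E →ₗ[ℝ] H :=
    { toFun := D
      map_add' := fun v v' => by
        rw [← sub_eq_zero]
        apply zero_of
        simp only [inner_sub_left, inner_sub_right, inner_add_left, inner_add_right, hDD, Ladd, Ladd']
        ring
      map_smul' := fun c v => by
        rw [← sub_eq_zero]
        apply zero_of
        simp only [inner_sub_left, inner_sub_right, inner_smul_left_eq_smul,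
          inner_smul_right_eq_smul, hDD, Lsmul, Lsmul', RingHom.id_apply, Complex.real_smul]
        ring }
  -- The bound `hΦ` is homogeneous in the first increment, so dividing by `t` and letting `t → 0`
  -- replaces that increment by `D v` at no cost.
  have hDΔ : ∀ ε > 0, ∃ δ > 0, ∀ v v' : E, ‖v‖ ≤ δ → ‖v'‖ ≤ δ →
      ‖inner ℂ (D v) (h (z + v') - h z) - L v v'‖ ≤ ε * ‖v‖ * ‖v'‖ := by
    intro ε hε
    obtain ⟨δ, hδ, hb⟩ := hΦ ε hε
    refine ⟨δ, hδ, fun v v' hv hv' => ?_⟩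
    have t1 : Tendsto (fun t => ‖inner ℂ (q v t) (h (z + v') - h z) - L v v'‖) (𝓝[≠] 0)
        (𝓝 ‖inner ℂ (D v) (h (z + v') - h z) - L v v'‖) :=
      (((hD v).inner tendsto_const_nhds).sub_const _).norm
    refine le_of_tendsto t1 ?_
    filter_upwards [self_mem_nhdsWithin, mem_nhdsWithin_of_mem_nhds (Metric.ball_mem_nhds 0 one_pos)]
      with t ht ht'
    have ht' : |t| < 1 := by simpa using ht'
    have ht : t ≠ 0 := ht
    have := hb (t • v) v' (by
      rw [norm_smul, Real.norm_eq_abs]; nlinarith [norm_nonneg v, abs_nonneg t]) hv'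
    rw [Lsmul] at this
    have e : inner ℂ (q v t) (h (z + v') - h z) - L v v' = ((t⁻¹ : ℝ) : ℂ) *
        (inner ℂ (h (z + t • v) - h z) (h (z + v') - h z) - t * L v v') := by
      have : (t : ℂ) ≠ 0 := by exact_mod_cast ht
      simp only [q, inner_smul_left_eq_smul, Complex.real_smul]
      push_cast
      field_simp
    rw [e, norm_mul, Complex.norm_real, norm_inv, Real.norm_eq_abs]
    have hta := abs_pos.2 ht
    calc _ ≤ |t|⁻¹ * (ε * ‖t • v‖ * ‖v'‖) := by gcongr
      _ = _ := by rw [norm_smul, Real.norm_eq_abs]; field_simp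
  refine ⟨Dl.toContinuousLinearMap, ?_⟩
  rw [hasFDerivAt_iff_isLittleO_nhds_zero, Asymptotics.isLittleO_iff]
  intro ε hε
  obtain ⟨δ, hδ, hb⟩ := hΦ (ε ^ 2 / 4) (by positivity)
  obtain ⟨δ', hδ', hb'⟩ := hDΔ (ε ^ 2 / 4) (by positivity)
  filter_upwards [Metric.ball_mem_nhds 0 (lt_min hδ hδ')] with v hv
  have hv : ‖v‖ < min δ δ' := by simpa using hv
  have a1 := hb v v (hv.le.trans (min_le_left _ _)) (hv.le.trans (min_le_left _ _))
  have a2 := hb' v v (hv.le.trans (min_le_right _ _)) (hv.le.trans (min_le_right _ _))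
  have a3 : ‖inner ℂ (h (z + v) - h z) (D v) - (starRingEnd ℂ) (L v v)‖ ≤ ε ^ 2 / 4 * ‖v‖ * ‖v‖ := by
    rw [← inner_conj_symm, ← map_sub, RCLike.norm_conj]; exact a2
  have hLc : (starRingEnd ℂ) (L v v) = L v v := by rw [← hDD, inner_conj_symm]
  rw [hLc] at a3
  change ‖h (z + v) - h z - D v‖ ≤ ε * ‖v‖
  -- Each bracket is at most `ε² / 4 * ‖v‖²`, and three of them stay below `(ε * ‖v‖)²`.
  have e : ((‖h (z + v) - h z - D v‖ ^ 2 : ℝ) : ℂ) =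
      (inner ℂ (h (z + v) - h z) (h (z + v) - h z) - L v v)
      - (inner ℂ (D v) (h (z + v) - h z) - L v v)
      - (inner ℂ (h (z + v) - h z) (D v) - L v v) := by
    have := inner_self_eq_norm_sq_to_K (𝕜 := ℂ) (h (z + v) - h z - D v)
    rw [inner_sub_left (h (z + v) - h z), inner_sub_right _ (h (z + v) - h z),
      inner_sub_right _ (h (z + v) - h z), hDD] at this
    push_cast
    rw [show ((‖h (z + v) - h z - D v‖ : ℂ)) ^ 2 = _ from this.symm]
    ring
  have n : ‖h (z + v) - h z - D v‖ ^ 2 ≤ (ε * ‖v‖) ^ 2 := by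
    have := congrArg norm e
    rw [Complex.norm_real, Real.norm_of_nonneg (by positivity)] at this
    rw [this]
    refine (norm_sub_le _ _).trans ?_
    have := norm_sub_le (inner ℂ (h (z + v) - h z) (h (z + v) - h z) - L v v)
      (inner ℂ (D v) (h (z + v) - h z) - L v v)
    nlinarith [sq_nonneg (ε * ‖v‖)]
  exact le_of_sq_le_sq n (by positivity)

/-- A map into a Hilbert space whose Gram kernel is smooth is smooth. -/
theorem contDiff_of_gram [FiniteDimensional ℝ E] [CompleteSpace H] {h : E → H}
    (hK : ContDiff ℝ ∞ (fun w : E × E => (inner ℂ (h w.1) (h w.2) : ℂ))) :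
    ContDiff ℝ ∞ h := by
  rw [contDiff_infty]
  intro n
  induction n generalizing h with
  | zero =>
    have := differentiable_of_gram (hK.of_le (by norm_cast))
    exact contDiff_zero.2 this.continuous
  | succ n ih =>
    have hd := differentiable_of_gram (hK.of_le (by norm_cast))
    have hKd := hK.differentiable (by simp)
    -- The Gram kernel of a directional derivative of `h` is a mixed second derivative of the
    -- original kernel, hence again smooth, so the induction closes.
    refine (contDiff_succ_iff_fderiv_apply (n := n)).2 ⟨hd, by simp, fun v => ih ?_⟩
    have e1 : ∀ w : E × E, fderiv ℝ (fun w : E × E => (inner ℂ (h w.1) (h w.2) : ℂ)) w (v, 0)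
        = inner ℂ (fderiv ℝ h w.1 v) (h w.2) := by
      intro w
      have := (((hd w.1).hasFDerivAt.comp w hasFDerivAt_fst).inner ℂ
        ((hd w.2).hasFDerivAt.comp w hasFDerivAt_snd))
      rw [show fderiv ℝ (fun w : E × E => (inner ℂ (h w.1) (h w.2) : ℂ)) w = _ from this.fderiv]
      simp [fderivInnerCLM_apply]
    have s1 : ContDiff ℝ ∞ (fun w : E × E => (inner ℂ (fderiv ℝ h w.1 v) (h w.2) : ℂ)) := by
      have := (hK.fderiv_right (m := ∞) (by simp)).clm_apply (contDiff_const (c := ((v, 0) : E × E)))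
      simpa only [e1] using this
    have s2 := (s1.fderiv_right (m := ∞) (by simp)).clm_apply
      (contDiff_const (c := ((0, v) : E × E)))
    convert s2 using 2 with w
    -- `fderiv ℝ h` is not yet known to be differentiable, so the second derivative is taken along a
    -- line that keeps the first variable fixed.
    have l : HasDerivAt (fun t : ℝ => ((w.1, w.2 + t • v) : E × E)) (0, v) 0 := by
      have := ((hasDerivAt_id (0 : ℝ)).smul_const v).const_add w.2
      simpa using (hasDerivAt_const (0 : ℝ) w.1).prodMk this
    have c1 := ((s1.differentiable (by simp) _).hasFDerivAt.comp_hasDerivAt (0 : ℝ) l)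
    have l2 : HasDerivAt (fun t : ℝ => w.2 + t • v) v 0 := by
      simpa using ((hasDerivAt_id (0 : ℝ)).smul_const v).const_add w.2
    have c2 := (hasDerivAt_const (0 : ℝ) (fderiv ℝ h w.1 v)).inner ℂ
      ((hd (w.2 + (0 : ℝ) • v)).hasFDerivAt.comp_hasDerivAt (0 : ℝ) l2)
    have := c1.unique c2
    simpa using this.symm

end Kernel

/-! ### Powers of the Poisson bracket on tensor products -/

section Poisson

variable {n : ℕ} {H : Type*} [NormedAddCommGroup H] [NormedSpace ℝ H]

/-- The derivative of a function on phase space in a fixed direction. -/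
noncomputable def dirD (v : Phase n) (a : Phase n → H) : Phase n → H := fun z => fderiv ℝ a z v

theorem contDiff_dirD {a : Phase n → H} (ha : ContDiff ℝ ∞ a) (v : Phase n) :
    ContDiff ℝ ∞ (dirD v a) :=
  (ha.fderiv_right (m := ∞) (by simp)).clm_apply contDiff_const

theorem contDiff_partialD {F : Phase n × Phase n → ℂ} (hF : ContDiff ℝ ∞ F)
    (v : Phase n × Phase n) : ContDiff ℝ ∞ (partialD v F) :=
  (hF.fderiv_right (m := ∞) (by simp)).clm_apply contDiff_const

theorem contDiff_poissonOp {F : Phase n × Phase n → ℂ} (hF : ContDiff ℝ ∞ F) :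
    ContDiff ℝ ∞ (poissonOp F) :=
  ContDiff.sum fun _ _ => (contDiff_partialD (contDiff_partialD hF _) _).sub
    (contDiff_partialD (contDiff_partialD hF _) _)

theorem partialD_sum {κ : Type*} (s : Finset κ) {F : κ → Phase n × Phase n → ℂ}
    (hF : ∀ k, ContDiff ℝ ∞ (F k)) (v : Phase n × Phase n) :
    partialD v (fun w => ∑ k ∈ s, F k w) = fun w => ∑ k ∈ s, partialD v (F k) w := by
  funext w
  simp only [partialD]
  rw [fderiv_fun_sum fun k _ => (hF k).differentiable (by simp) w]
  simp

theorem partialD_sub {F G : Phase n × Phase n → ℂ} (hF : ContDiff ℝ ∞ F) (hG : ContDiff ℝ ∞ G)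
    (v : Phase n × Phase n) :
    partialD v (fun w => F w - G w) = fun w => partialD v F w - partialD v G w := by
  funext w
  simp only [partialD]
  rw [fderiv_fun_sub (hF.differentiable (by simp) w) (hG.differentiable (by simp) w)]
  simp

theorem poissonOp_sum {κ : Type*} (s : Finset κ) {F : κ → Phase n × Phase n → ℂ}
    (hF : ∀ k, ContDiff ℝ ∞ (F k)) :
    poissonOp (fun w => ∑ k ∈ s, F k w) = fun w => ∑ k ∈ s, poissonOp (F k) w := by
  funext w
  simp only [poissonOp]
  rw [Finset.sum_comm]
  refine Finset.sum_congr rfl fun i _ => ?_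
  simp only [partialD_sum s hF, partialD_sum s fun k => contDiff_partialD (hF k) _,
    Finset.sum_sub_distrib]

theorem poissonOp_sub {F G : Phase n × Phase n → ℂ} (hF : ContDiff ℝ ∞ F)
    (hG : ContDiff ℝ ∞ G) :
    poissonOp (fun w => F w - G w) = fun w => poissonOp F w - poissonOp G w := by
  funext w
  simp only [poissonOp]
  rw [← Finset.sum_sub_distrib]
  refine Finset.sum_congr rfl fun i _ => ?_
  simp only [partialD_sub hF hG, partialD_sub (contDiff_partialD hF _) (contDiff_partialD hG _)]
  ring

theorem contDiff_poissonOp_iterate {F : Phase n × Phase n → ℂ} (hF : ContDiff ℝ ∞ F) (r : ℕ) :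
    ContDiff ℝ ∞ (poissonOp^[r] F) := by
  induction r with
  | zero => exact hF
  | succ r ih => rw [Function.iterate_succ_apply']; exact contDiff_poissonOp ih

theorem poissonOp_iterate_sum {κ : Type*} (s : Finset κ) {F : κ → Phase n × Phase n → ℂ}
    (hF : ∀ k, ContDiff ℝ ∞ (F k)) (r : ℕ) :
    poissonOp^[r] (fun w => ∑ k ∈ s, F k w) = fun w => ∑ k ∈ s, poissonOp^[r] (F k) w := by
  induction r with
  | zero => rfl
  | succ r ih =>
    simp only [Function.iterate_succ_apply']
    rw [ih, poissonOp_sum s fun k => contDiff_poissonOp_iterate (hF k) r]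

theorem poissonOp_iterate_sub {F G : Phase n × Phase n → ℂ} (hF : ContDiff ℝ ∞ F)
    (hG : ContDiff ℝ ∞ G) (r : ℕ) :
    poissonOp^[r] (fun w => F w - G w) = fun w => poissonOp^[r] F w - poissonOp^[r] G w := by
  induction r with
  | zero => rfl
  | succ r ih =>
    simp only [Function.iterate_succ_apply']
    rw [ih, poissonOp_sub (contDiff_poissonOp_iterate hF r) (contDiff_poissonOp_iterate hG r)]

theorem contDiff_tensor {a b : Phase n → ℂ} (ha : ContDiff ℝ ∞ a) (hb : ContDiff ℝ ∞ b) :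
    ContDiff ℝ ∞ (fun w : Phase n × Phase n => a w.1 * b w.2) :=
  (ha.comp contDiff_fst).mul (hb.comp contDiff_snd)

theorem partialD_tensor {a b : Phase n → ℂ} (ha : ContDiff ℝ ∞ a) (hb : ContDiff ℝ ∞ b)
    (v v' : Phase n) :
    partialD (v, v') (fun w => a w.1 * b w.2)
      = fun w => dirD v a w.1 * b w.2 + a w.1 * dirD v' b w.2 := by
  funext w
  have h1 := ((ha.differentiable (by simp) w.1).hasFDerivAt.comp w hasFDerivAt_fst)
  have h2 := ((hb.differentiable (by simp) w.2).hasFDerivAt.comp w hasFDerivAt_snd)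
  have := (h1.mul h2).fderiv
  simp only [partialD, dirD]
  rw [show fderiv ℝ (fun w : Phase n × Phase n => a w.1 * b w.2) w = _ from this]
  simp
  ring

@[simp] theorem dirD_zero (a : Phase n → H) : dirD 0 a = 0 := by
  funext z; simp [dirD]

theorem poissonOp_tensor {a b : Phase n → ℂ} (ha : ContDiff ℝ ∞ a) (hb : ContDiff ℝ ∞ b) :
    poissonOp (fun w => a w.1 * b w.2) = fun w => ∑ i : Fin n,
      (dirD (xDir i) a w.1 * dirD (pDir i) b w.2 - dirD (pDir i) a w.1 * dirD (xDir i) b w.2) := by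
  funext w
  simp only [poissonOp]
  refine Finset.sum_congr rfl fun i _ => ?_
  have e1 : partialD (0, pDir i) (fun w : Phase n × Phase n => a w.1 * b w.2)
      = fun w => a w.1 * dirD (pDir i) b w.2 := by
    rw [partialD_tensor ha hb]; simp
  have e2 : partialD (pDir i, 0) (fun w : Phase n × Phase n => a w.1 * b w.2)
      = fun w => dirD (pDir i) a w.1 * b w.2 := by
    rw [partialD_tensor ha hb]; simp
  rw [e1, e2, partialD_tensor ha (contDiff_dirD hb _), partialD_tensor (contDiff_dirD ha _) hb]
  simp

/-- The recursion for the powers of the Poisson bracket. -/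
theorem poissonPow_succ {a b : Phase n → ℂ} (ha : ContDiff ℝ ∞ a) (hb : ContDiff ℝ ∞ b) (r : ℕ)
    (z : Phase n) :
    poissonPow (r + 1) a b z = ∑ i : Fin n,
      (poissonPow r (dirD (xDir i) a) (dirD (pDir i) b) z
        - poissonPow r (dirD (pDir i) a) (dirD (xDir i) b) z) := by
  -- The application peeled off is the one acting first: it meets a genuine tensor product and
  -- returns a sum of tensor products.
  simp only [poissonPow, Function.iterate_succ_apply]
  have s1 : ∀ i : Fin n, ContDiff ℝ ∞
      (fun w : Phase n × Phase n => dirD (xDir i) a w.1 * dirD (pDir i) b w.2) :=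
    fun i => contDiff_tensor (contDiff_dirD ha _) (contDiff_dirD hb _)
  have s2 : ∀ i : Fin n, ContDiff ℝ ∞
      (fun w : Phase n × Phase n => dirD (pDir i) a w.1 * dirD (xDir i) b w.2) :=
    fun i => contDiff_tensor (contDiff_dirD ha _) (contDiff_dirD hb _)
  rw [poissonOp_tensor ha hb, poissonOp_iterate_sum _ fun i => (s1 i).sub (s2 i)]
  simp only [poissonOp_iterate_sub (s1 _) (s2 _)]

/-- The powers of the Poisson bracket commute with continuous linear functionals applied to the
first argument. -/
theorem exists_poissonPow_clm {H : Type*} [NormedAddCommGroup H] [NormedSpace ℂ H]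
    {h : Phase n → H} (hh : ContDiff ℝ ∞ h) {b : Phase n → ℂ} (hb : ContDiff ℝ ∞ b) (r : ℕ)
    (z : Phase n) :
    ∃ v : H, ∀ L : H →L[ℂ] ℂ, poissonPow r (fun z => L (h z)) b z = L v := by
  induction r generalizing h b with
  | zero => exact ⟨b z • h z, fun L => by simp [poissonPow, mul_comm]⟩
  | succ r ih =>
    choose u hu using fun i : Fin n => ih (contDiff_dirD hh (xDir i)) (contDiff_dirD hb (pDir i))
    choose u' hu' using fun i : Fin n => ih (contDiff_dirD hh (pDir i)) (contDiff_dirD hb (xDir i))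
    refine ⟨∑ i, (u i - u' i), fun L => ?_⟩
    have hL : ∀ v, dirD v (fun z => L (h z)) = fun z => L (dirD v h z) := by
      intro v
      funext z
      have := (L.restrictScalars ℝ).hasFDerivAt.comp z (hh.differentiable (by simp) z).hasFDerivAt
      simp only [dirD]
      rw [show fderiv ℝ (fun z => L (h z)) z = _ from this.fderiv]
      simp
    have hs : ContDiff ℝ ∞ (fun z => L (h z)) := (L.restrictScalars ℝ).contDiff.comp hh
    rw [poissonPow_succ hs hb]
    simp only [hL, hu, hu', map_sum, map_sub]

end Poisson

/-! ### Taylor's formula with a global remainder bound -/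

section Taylor

variable {E : Type*} [NormedAddCommGroup E] [NormedSpace ℝ E]

theorem iteratedDeriv_comp_line {b : E → ℂ} (hb : ContDiff ℝ ∞ b) (z u : E) (r : ℕ) (t : ℝ) :
    iteratedDeriv r (fun t : ℝ => b (z + t • u)) t
      = iteratedFDeriv ℝ r b (z + t • u) (fun _ => u) := by
  induction r generalizing t with
  | zero => simp
  | succ r ih =>
    rw [iteratedDeriv_succ, show iteratedDeriv r (fun t : ℝ => b (z + t • u)) = _ from funext ih,
      iteratedFDeriv_succ_apply_left]
    have l : HasDerivAt (fun t : ℝ => z + t • u) u t := by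
      simpa using ((hasDerivAt_id t).smul_const u).const_add z
    have d := ((hb.differentiable_iteratedFDeriv (m := r)
      (by exact_mod_cast ENat.natCast_lt_top r)) (z + t • u)).hasFDerivAt.comp_hasDerivAt t l
    have := (ContinuousMultilinearMap.apply ℝ (fun _ : Fin r => E) ℂ
      (fun _ => u)).hasFDerivAt.comp_hasDerivAt t d
    rw [show deriv (fun t : ℝ => iteratedFDeriv ℝ r b (z + t • u) fun _ => u) t = _ from this.deriv]
    rfl

/-- Taylor's formula for a bounded smooth function, uniformly on a compact set of base points and
without restriction on the increment. -/
theorem exists_taylor_bound [FiniteDimensional ℝ E] {b : E → ℂ} (hb : ContDiff ℝ ∞ b) {M : ℝ}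
    (hM : ∀ z, ‖b z‖ ≤ M) {K : Set E} (hK : IsCompact K) (N : ℕ) :
    ∃ C, ∀ z ∈ K, ∀ u, ‖b (z + u) - ∑ r ∈ Finset.range N,
      (1 / (r.factorial : ℂ)) * iteratedFDeriv ℝ r b z (fun _ => u)‖ ≤ C * ‖u‖ ^ N := by
  have hM0 : 0 ≤ M := (norm_nonneg _).trans (hM 0)
  have hcont : ∀ r : ℕ, Continuous (iteratedFDeriv ℝ r b) := fun r =>
    hb.continuous_iteratedFDeriv (by exact_mod_cast le_top)
  rcases N with _ | m
  · exact ⟨M, fun z _ u => by simpa using hM _⟩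
  have : ProperSpace E := FiniteDimensional.proper_real E
  -- The closed 1-thickening contains every segment from `z ∈ K` to `z + u` with `‖u‖ ≤ 1`.
  obtain ⟨C₁, hC₁⟩ := (hK.cthickening (r := 1)).exists_bound_of_continuousOn
    (hcont (m + 1)).continuousOn
  choose c hc using fun r : ℕ => hK.exists_bound_of_continuousOn (hcont r).continuousOn
  refine ⟨|C₁| + M + ∑ r ∈ Finset.range (m + 1), |c r|, fun z hz u => ?_⟩
  have hS : 0 ≤ ∑ r ∈ Finset.range (m + 1), |c r| := Finset.sum_nonneg fun _ _ => abs_nonneg _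
  -- Short increments use the Taylor remainder. For long ones no cancellation is needed: `M` and
  -- every Taylor term are separately dominated by a multiple of `‖u‖ ^ (m + 1)`.
  rcases le_or_gt ‖u‖ 1 with hu | hu
  · have hg : ContDiff ℝ ∞ (fun t : ℝ => b (z + t • u)) := by fun_prop
    have hw : ∀ r : ℕ, ∀ t ∈ Set.Icc (0 : ℝ) 1,
        iteratedDerivWithin r (fun t : ℝ => b (z + t • u)) (Set.Icc 0 1) t
          = iteratedFDeriv ℝ r b (z + t • u) (fun _ => u) := fun r t ht => by
      rw [iteratedDerivWithin_eq_iteratedDeriv (uniqueDiffOn_Icc one_pos)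
        (hg.contDiffAt.of_le (by exact_mod_cast le_top)) ht, iteratedDeriv_comp_line hb]
    have := taylor_mean_remainder_bound (f := fun t : ℝ => b (z + t • u)) (n := m)
      (C := |C₁| * ‖u‖ ^ (m + 1)) zero_le_one
      ((hg.of_le (by exact_mod_cast le_top)).contDiffOn) (Set.right_mem_Icc.2 zero_le_one) ?_
    · rw [taylor_within_apply] at this
      have e : ∀ r ∈ Finset.range (m + 1), (((r.factorial : ℝ)⁻¹ * ((1 : ℝ) - 0) ^ r) •
          iteratedDerivWithin r (fun t : ℝ => b (z + t • u)) (Set.Icc 0 1) 0)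
          = (1 / (r.factorial : ℂ)) * iteratedFDeriv ℝ r b z (fun _ => u) := fun r _ => by
        rw [hw r 0 (Set.left_mem_Icc.2 zero_le_one)]
        simp
      rw [Finset.sum_congr rfl e] at this
      simp only [one_smul, sub_zero, one_pow, mul_one] at this
      refine this.trans ((div_le_self (by positivity) ?_).trans ?_)
      · exact_mod_cast Nat.one_le_iff_ne_zero.2 (Nat.factorial_ne_zero m)
      · gcongr; linarith
    · intro t ht
      rw [hw _ t ht]
      refine (ContinuousMultilinearMap.le_opNorm _ _).trans ?_
      simp only [Finset.prod_const, Finset.card_univ, Fintype.card_fin]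
      gcongr
      refine (hC₁ _ ?_).trans (le_abs_self _)
      refine Metric.mem_cthickening_of_dist_le _ z _ _ hz ?_
      rw [dist_self_add_left, norm_smul, Real.norm_eq_abs, abs_of_nonneg ht.1]
      nlinarith [ht.2, norm_nonneg u]
  · have h1 : ∀ r ∈ Finset.range (m + 1),
        ‖(1 / (r.factorial : ℂ)) * iteratedFDeriv ℝ r b z (fun _ => u)‖
          ≤ |c r| * ‖u‖ ^ (m + 1) := by
      intro r hr
      rw [norm_mul]
      have f1 : ‖(1 / (r.factorial : ℂ))‖ ≤ 1 := by
        rw [norm_div, norm_one, Complex.norm_natCast]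
        exact div_le_one_of_le₀ (by exact_mod_cast Nat.one_le_iff_ne_zero.2 (Nat.factorial_ne_zero r))
          (by positivity)
      have f2 : ‖iteratedFDeriv ℝ r b z (fun _ => u)‖ ≤ |c r| * ‖u‖ ^ r := by
        refine (ContinuousMultilinearMap.le_opNorm _ _).trans ?_
        simp only [Finset.prod_const, Finset.card_univ, Fintype.card_fin]
        gcongr
        exact (hc r z hz).trans (le_abs_self _)
      calc _ ≤ 1 * (|c r| * ‖u‖ ^ r) := by gcongr
        _ ≤ |c r| * ‖u‖ ^ (m + 1) := by
          rw [one_mul]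
          gcongr
          · exact hu.le
          · exact (Finset.mem_range.1 hr).le
    have h2 : M ≤ M * ‖u‖ ^ (m + 1) := le_mul_of_one_le_right hM0 (one_le_pow₀ hu.le)
    calc _ ≤ ‖b (z + u)‖ + ‖∑ r ∈ Finset.range (m + 1),
          (1 / (r.factorial : ℂ)) * iteratedFDeriv ℝ r b z (fun _ => u)‖ := norm_sub_le _ _
      _ ≤ M * ‖u‖ ^ (m + 1) + ∑ r ∈ Finset.range (m + 1), |c r| * ‖u‖ ^ (m + 1) := by
          gcongr
          · exact (hM _).trans h2
          · exact (norm_sum_le _ _).trans (Finset.sum_le_sum h1)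
      _ = (M + ∑ r ∈ Finset.range (m + 1), |c r|) * ‖u‖ ^ (m + 1) := by
          rw [← Finset.sum_mul]; ring
      _ ≤ _ := by gcongr; linarith [abs_nonneg C₁]

end Taylor

/-! ### Elementary properties of the symplectic form -/

section Sympl

variable {n : ℕ}

theorem sympl_sub_left (u v w : Phase n) : sympl (u - v) w = sympl u w - sympl v w := by
  simp only [sympl, Prod.fst_sub, Prod.snd_sub, inner_sub_left]; ring

theorem sympl_smul_right (c : ℝ) (u w : Phase n) : sympl u (c • w) = c * sympl u w := by
  simp only [sympl, Prod.smul_fst, Prod.smul_snd, inner_smul_right]; ring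

theorem sympl_smul_left (c : ℝ) (u w : Phase n) : sympl (c • u) w = c * sympl u w := by
  simp only [sympl, Prod.smul_fst, Prod.smul_snd, real_inner_smul_left]; ring

theorem sympl_swap (u w : Phase n) : sympl u w = - sympl w u := by
  simp only [sympl, real_inner_comm]; ring

theorem contDiff_sympl {X : Type*} [NormedAddCommGroup X] [NormedSpace ℝ X] {f g : X → Phase n}
    {m : WithTop ℕ∞} (hf : ContDiff ℝ m f) (hg : ContDiff ℝ m g) :
    ContDiff ℝ m (fun x => sympl (f x) (g x)) :=
  ((hf.snd).inner ℝ hg.fst).sub ((hf.fst).inner ℝ hg.snd)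

theorem continuous_sympl {X : Type*} [TopologicalSpace X] {f g : X → Phase n}
    (hf : Continuous f) (hg : Continuous g) : Continuous (fun x => sympl (f x) (g x)) :=
  ((hf.snd).inner hg.fst).sub ((hf.fst).inner hg.snd)

theorem norm_cexp_ofReal_mul_I (c : ℝ) : ‖Complex.exp (2 * Complex.I * (c : ℂ))‖ = 1 := by
  rw [show 2 * Complex.I * (c : ℂ) = ((2 * c : ℝ) : ℂ) * Complex.I by push_cast; ring]
  exact Complex.norm_exp_ofReal_mul_I _

end Sympl

/-! ### Common integral form of the Moyal and Bopp products -/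

section Transform

variable {n : ℕ}

/-- The unnormalized symplectic Fourier transform `w ↦ ∫ exp(-2iσ(u,w)) a(u) du`. -/
noncomputable def chordFT (a : Phase n → ℂ) : Phase n → ℂ := fun w =>
  ∫ u : Phase n, Complex.exp (-(2 * Complex.I * (sympl u w : ℂ))) * a u

instance instIsAddHaarMeasurePhase : (volume : Measure (Phase n)).IsAddHaarMeasure :=
  inferInstanceAs ((volume : Measure (Conf n)).prod (volume : Measure (Conf n))).IsAddHaarMeasure

theorem finrank_phase : Module.finrank ℝ (Phase n) = 2 * n := by
  simp [Phase, Conf, two_mul]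

/-- Substitute `v = z + ε • w`: since `σ(u - z, εw) / ε = σ(u,w) - σ(z,w)`, the phase loses its `ε`,
and the Jacobian `ε²ⁿ` cancels the prefactor. -/
theorem moyal_eq {ε : ℝ} (hε : 0 < ε) (a b : Phase n → ℂ) (z : Phase n) :
    moyal ε a b z = (((1 / Real.pi) ^ (2 * n) : ℝ) : ℂ) *
      ∫ w : Phase n, Complex.exp (2 * Complex.I * (sympl z w : ℂ)) * chordFT a w * b (z + ε • w) := by
  have hε' : (ε : ℂ) ≠ 0 := by exact_mod_cast hε.ne'
  simp only [moyal]
  set F : Phase n → ℂ := fun v => ∫ u : Phase n,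
      Complex.exp (-(2 * Complex.I / (ε : ℂ)) * (sympl (u - z) (v - z) : ℂ)) * a u * b v with hF
  have e1 : ∀ w, F (z + ε • w)
      = Complex.exp (2 * Complex.I * (sympl z w : ℂ)) * chordFT a w * b (z + ε • w) := by
    intro w
    simp only [hF, chordFT]
    rw [← integral_const_mul, ← integral_mul_const]
    congr 1
    funext u
    rw [← mul_assoc, ← Complex.exp_add]
    congr 3
    rw [add_sub_cancel_left, sympl_smul_right, sympl_sub_left]
    push_cast
    field_simp
    ring
  have e2 : ∫ w, F (z + ε • w) = (((ε ^ (2 * n))⁻¹ : ℝ) : ℂ) * ∫ v, F v := by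
    have := Measure.integral_comp_smul (volume : Measure (Phase n)) (fun w => F (z + w)) ε
    rw [this, integral_add_left_eq_self, finrank_phase, abs_of_nonneg (by positivity),
      Complex.real_smul]
  simp only [← e1]
  rw [e2, ← mul_assoc]
  congr 1
  push_cast
  rw [← inv_pow, ← mul_pow]
  congr 1
  field_simp

/-- Substitute `z₀ = -2ħw`: then `z - z₀/2 = z + ħw`, and both phases become those of `moyal_eq`. -/
theorem boppOp_eq {hbar : ℝ} (hbar_pos : 0 < hbar) (a Ψ : Phase n → ℂ) (z : Phase n) :
    boppOp hbar a Ψ z = moyal hbar a Ψ z := by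
  have hh : (hbar : ℂ) ≠ 0 := by exact_mod_cast hbar_pos.ne'
  have hpi : (Real.pi : ℂ) ≠ 0 := by exact_mod_cast Real.pi_ne_zero
  rw [moyal_eq hbar_pos]
  simp only [boppOp]
  set F : Phase n → ℂ := fun z₀ => symplFourier hbar a z₀ * boppShift hbar z₀ Ψ z with hF
  have e1 : ∀ w, F ((-2 * hbar) • w) = (((1 / (2 * Real.pi * hbar)) ^ n : ℝ) : ℂ) *
      (Complex.exp (2 * Complex.I * (sympl z w : ℂ)) * chordFT a w * Ψ (z + hbar • w)) := by
    intro w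
    simp only [hF, chordFT, symplFourier, boppShift, smul_smul]
    have e3 : z - ((1 / 2) * (-2 * hbar)) • w = z + hbar • w := by
      rw [show (1 / 2) * (-2 * hbar) = -hbar by ring, neg_smul, sub_neg_eq_add]
    have e4 : Complex.exp (-(Complex.I / (hbar : ℂ)) * (sympl z ((-2 * hbar) • w) : ℂ))
        = Complex.exp (2 * Complex.I * (sympl z w : ℂ)) := by
      rw [sympl_smul_right]; push_cast; congr 1; field_simp
    have e5 : ∀ u, Complex.exp (-(Complex.I / (hbar : ℂ)) * (sympl ((-2 * hbar) • w) u : ℂ))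
        = Complex.exp (-(2 * Complex.I * (sympl u w : ℂ))) := fun u => by
      rw [sympl_smul_left, sympl_swap w u]; push_cast; congr 1; field_simp
    rw [e3, e4]
    simp only [e5]
    ring
  have e2 : ∫ w, F ((-2 * hbar) • w) = ((((2 * hbar) ^ (2 * n))⁻¹ : ℝ) : ℂ) * ∫ v, F v := by
    rw [Measure.integral_comp_smul, finrank_phase, Complex.real_smul]
    congr 2
    rw [pow_mul, show (-2 * hbar) ^ 2 = (2 * hbar) ^ 2 by ring, ← pow_mul,
      abs_of_nonneg (by positivity)]
  simp only [e1] at e2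
  rw [integral_const_mul] at e2
  have e3 : ∫ v, F v = (((2 * hbar) ^ (2 * n) : ℝ) : ℂ) *
      (((((2 * hbar) ^ (2 * n))⁻¹ : ℝ) : ℂ) * ∫ v, F v) := by
    push_cast
    field_simp
  rw [e3, ← e2, ← mul_assoc, ← mul_assoc]
  congr 1
  push_cast
  rw [pow_mul, pow_mul, ← mul_pow, ← mul_pow]
  congr 1
  field_simp

end Transform

/-! ### The symplectic Fourier transform on Schwartz functions -/

section SchwartzTransform

open scoped FourierTransform SchwartzMap LineDeriv

variable {n : ℕ}

/-- Phase space with the sup norm and with the Euclidean norm. -/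
noncomputable def phaseE : WithLp 2 (Conf n × Conf n) ≃L[ℝ] Phase n :=
  WithLp.prodContinuousLinearEquiv 2 ℝ (Conf n) (Conf n)

/-- The map `(x, p) ↦ π⁻¹ (-p, x)`. -/
noncomputable def rotL : Phase n ≃ₗ[ℝ] Phase n where
  toFun w := (-(Real.pi⁻¹ • w.2), Real.pi⁻¹ • w.1)
  invFun w := (Real.pi • w.2, -(Real.pi • w.1))
  map_add' v w := Prod.ext (by simp [add_comm]) (by simp)
  map_smul' c w := Prod.ext (by simp [smul_comm c]) (by simp [smul_comm c])
  left_inv w := Prod.ext (by simp [smul_smul, Real.pi_ne_zero])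
    (by simp [smul_smul, Real.pi_ne_zero])
  right_inv w := Prod.ext (by simp [smul_smul, Real.pi_ne_zero])
    (by simp [smul_smul, Real.pi_ne_zero])

/-- The map `(x, p) ↦ π⁻¹ (-p, x)`, with values in the Euclidean version of phase space. -/
noncomputable def rotE : Phase n ≃L[ℝ] WithLp 2 (Conf n × Conf n) :=
  rotL.toContinuousLinearEquiv.trans phaseE.symm

theorem rotE_apply (w : Phase n) :
    rotE w = WithLp.toLp 2 (-(Real.pi⁻¹ • w.2), Real.pi⁻¹ • w.1) := rfl

/-- The rotation turns the Euclidean product into `σ`, and the factor `π⁻¹` turns the phase `2π⟨v,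
ξ⟩` of the standard Fourier transform into `2σ`. -/
theorem inner_rotE (v : WithLp 2 (Conf n × Conf n)) (w : Phase n) :
    inner ℝ v (rotE w) = Real.pi⁻¹ * sympl (phaseE v) w := by
  rw [rotE_apply, WithLp.prod_inner_apply]
  simp only [sympl, phaseE, WithLp.prodContinuousLinearEquiv_apply, inner_neg_right,
    inner_smul_right]
  ring

theorem integral_phaseE (f : Phase n → ℂ) : ∫ v, f (phaseE v) = ∫ z, f z :=
  (WithLp.volume_preserving_ofLp (U := Conf n) (V := Conf n)).integral_comp
    (MeasurableEquiv.toLp 2 (Conf n × Conf n)).symm.measurableEmbedding f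

theorem integral_rotE (f : WithLp 2 (Conf n × Conf n) → ℂ) :
    ∫ ξ, f ξ = (((1 / Real.pi) ^ (2 * n) : ℝ) : ℂ) * ∫ w, f (rotE w) := by
  have h1 : ∫ ξ, f ξ = ∫ z : Phase n, f (WithLp.toLp 2 z) :=
    ((WithLp.volume_preserving_toLp (U := Conf n) (V := Conf n)).integral_comp
      (MeasurableEquiv.toLp 2 (Conf n × Conf n)).measurableEmbedding f).symm
  let g : Phase n → ℂ := fun z => f (WithLp.toLp 2 (Real.pi⁻¹ • z))
  have h2 : ∫ w, f (rotE w) = ∫ z : Phase n, g z := by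
    have mp : MeasurePreserving (fun w : Phase n => ((-w.2, w.1) : Phase n)) volume volume := by
      have := ((Measure.measurePreserving_neg (volume : Measure (Conf n))).prod
        (MeasurePreserving.id (volume : Measure (Conf n)))).comp
        (Measure.measurePreserving_swap (μ := (volume : Measure (Conf n)))
          (ν := (volume : Measure (Conf n))))
      exact this
    have me : MeasurableEmbedding (fun w : Phase n => ((-w.2, w.1) : Phase n)) :=
      ((MeasurableEquiv.prodComm).trans ((MeasurableEquiv.neg (Conf n)).prodCongr
        (MeasurableEquiv.refl (Conf n)))).measurableEmbedding
    rw [← mp.integral_comp me g]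
    simp only [g, rotE_apply, Prod.smul_mk, smul_neg]
  have h3 : ∫ z : Phase n, g z = ((Real.pi ^ (2 * n) : ℝ) : ℂ) *
      ∫ z : Phase n, f (WithLp.toLp 2 z) := by
    rw [Measure.integral_comp_smul (volume : Measure (Phase n))
      (fun z => f (WithLp.toLp 2 z)) Real.pi⁻¹, finrank_phase, abs_of_nonneg (by positivity),
      Complex.real_smul]
    congr 2
    simp
  rw [h2, h3, h1, ← mul_assoc, ← Complex.ofReal_mul, ← mul_pow]
  simp [Real.pi_ne_zero]

/-- The unnormalized symplectic Fourier transform of a Schwartz function. -/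
noncomputable def chordS (a : 𝓢(Phase n, ℂ)) : 𝓢(Phase n, ℂ) :=
  SchwartzMap.compCLMOfContinuousLinearEquiv ℂ rotE
    (𝓕 (SchwartzMap.compCLMOfContinuousLinearEquiv ℂ phaseE a))

theorem chordS_apply (a : 𝓢(Phase n, ℂ)) (w : Phase n) : chordS a w = chordFT a w := by
  rw [chordS, SchwartzMap.compCLMOfContinuousLinearEquiv_apply, Function.comp_apply,
    SchwartzMap.fourier_coe, Real.fourier_eq', chordFT, ← integral_phaseE]
  congr 1
  funext v
  rw [smul_eq_mul, inner_rotE]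
  refine congrArg₂ (· * ·) (congrArg Complex.exp ?_) rfl
  have : (Real.pi : ℂ) ≠ 0 := by exact_mod_cast Real.pi_ne_zero
  push_cast
  field_simp

theorem chordS_inversion (a : 𝓢(Phase n, ℂ)) (z : Phase n) :
    a z = (((1 / Real.pi) ^ (2 * n) : ℝ) : ℂ) *
      ∫ w, Complex.exp (2 * Complex.I * (sympl z w : ℂ)) * chordS a w := by
  set a' := SchwartzMap.compCLMOfContinuousLinearEquiv ℂ phaseE a with ha'
  have h : 𝓕⁻ (𝓕 a') (phaseE.symm z) = a z := by
    rw [FourierTransform.fourierInv_fourier_eq]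
    simp [ha']
  rw [← h, SchwartzMap.fourierInv_coe, Real.fourierInv_eq', integral_rotE]
  congr 2
  funext w
  rw [smul_eq_mul, real_inner_comm, inner_rotE]
  refine congrArg₂ (· * ·) (congrArg Complex.exp ?_) rfl
  have : (Real.pi : ℂ) ≠ 0 := by exact_mod_cast Real.pi_ne_zero
  push_cast
  rw [ContinuousLinearEquiv.apply_symm_apply]
  field_simp

theorem chordS_lineDeriv (a : 𝓢(Phase n, ℂ)) (v w : Phase n) :
    chordS (∂_{v} a) w = 2 * Complex.I * (sympl v w : ℂ) * chordS a w := by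
  have h := SchwartzMap.lineDerivOp_compCLMOfContinuousLinearEquiv (𝕜 := ℂ) (phaseE.symm v) phaseE a
  rw [ContinuousLinearEquiv.apply_symm_apply] at h
  have ht : (inner ℝ · (phaseE.symm v)).HasTemperateGrowth :=
    ((innerSL ℝ).flip (phaseE.symm v)).hasTemperateGrowth
  rw [chordS, ← h, SchwartzMap.fourier_lineDerivOp_eq]
  simp only [chordS, SchwartzMap.compCLMOfContinuousLinearEquiv_apply, Function.comp_apply,
    smul_apply, SchwartzMap.smulLeftCLM_apply_apply ht]
  rw [real_inner_comm, inner_rotE, ContinuousLinearEquiv.apply_symm_apply, Complex.real_smul,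
    smul_eq_mul]
  have : (Real.pi : ℂ) ≠ 0 := by exact_mod_cast Real.pi_ne_zero
  push_cast
  field_simp

theorem coe_lineDeriv (a : 𝓢(Phase n, ℂ)) (v : Phase n) : (∂_{v} a : 𝓢(Phase n, ℂ)) = dirD v a := by
  funext z
  simp [SchwartzMap.lineDerivOp_apply_eq_fderiv, dirD]

end SchwartzTransform

/-! ### Semiclassical expansion of the Moyal product -/

section Asymptotics

open scoped SchwartzMap LineDeriv

variable {n : ℕ}

theorem phase_eq_sum (w : Phase n) :
    w = ∑ i : Fin n, ((w.1 i) • xDir i + (w.2 i) • pDir i : Phase n) := by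
  ext j
  · simp [xDir, pDir, Prod.fst_sum, Pi.single_apply]
  · simp [xDir, pDir, Prod.snd_sum, Pi.single_apply]

theorem sympl_xDir (i : Fin n) (w : Phase n) : sympl (xDir i) w = - w.2 i := by
  simp [sympl, xDir, EuclideanSpace.inner_single_left]

theorem sympl_pDir (i : Fin n) (w : Phase n) : sympl (pDir i) w = w.1 i := by
  simp [sympl, pDir, EuclideanSpace.inner_single_left]

theorem iteratedFDeriv_succ_apply_const {b : Phase n → ℂ} (hb : ContDiff ℝ ∞ b) (r : ℕ)
    (z w : Phase n) :
    iteratedFDeriv ℝ (r + 1) b z (fun _ => w) = ∑ i : Fin n,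
      ((w.1 i : ℂ) * iteratedFDeriv ℝ r (dirD (xDir i) b) z (fun _ => w)
        + (w.2 i : ℂ) * iteratedFDeriv ℝ r (dirD (pDir i) b) z (fun _ => w)) := by
  have hd : ContDiff ℝ ∞ (fderiv ℝ b) := hb.fderiv_right (by simp)
  have h : ∀ d : Phase n, iteratedFDeriv ℝ r (dirD d b) z (fun _ => w)
      = iteratedFDeriv ℝ r (fderiv ℝ b) z (fun _ => w) d := by
    intro d
    have := (ContinuousLinearMap.apply ℝ ℂ d).iteratedFDeriv_comp_left (i := r) (n := ∞)
      (hd.contDiffAt (x := z)) (by exact_mod_cast le_top)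
    rw [show dirD d b = ContinuousLinearMap.apply ℝ ℂ d ∘ fderiv ℝ b from rfl, this]
    rfl
  simp only [h]
  rw [iteratedFDeriv_succ_apply_right]
  set T : Phase n →L[ℝ] ℂ := iteratedFDeriv ℝ r (fderiv ℝ b) z (fun _ => w) with hT
  change T w = _
  conv_lhs => rw [phase_eq_sum w]
  simp [map_sum]

theorem integrable_chord_mul_iteratedFDeriv (a : 𝓢(Phase n, ℂ)) (b : Phase n → ℂ) (r : ℕ)
    (z : Phase n) :
    Integrable (fun w => Complex.exp (2 * Complex.I * (sympl z w : ℂ)) * a w *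
      iteratedFDeriv ℝ r b z (fun _ => w)) := by
  refine ((a.integrable_pow_mul volume r).const_mul ‖iteratedFDeriv ℝ r b z‖).mono' ?_ ?_
  · refine Continuous.aestronglyMeasurable ?_
    have h1 : Continuous fun w : Phase n => sympl z w := continuous_sympl continuous_const continuous_id
    have h2 : Continuous fun w : Phase n => iteratedFDeriv ℝ r b z (fun _ => w) :=
      (iteratedFDeriv ℝ r b z).cont.comp (continuous_pi fun _ => continuous_id)
    have := a.continuous
    fun_prop
  · refine Eventually.of_forall fun w => ?_
    rw [norm_mul, norm_mul, norm_cexp_ofReal_mul_I, one_mul]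
    have := (iteratedFDeriv ℝ r b z).le_opNorm (fun _ => w)
    simp only [Finset.prod_const, Finset.card_univ, Fintype.card_fin] at this
    calc _ ≤ ‖a w‖ * (‖iteratedFDeriv ℝ r b z‖ * ‖w‖ ^ r) := by gcongr
      _ = _ := by ring

/-- The Taylor coefficients of the Moyal product are given by the powers of the Poisson bracket. -/
theorem integral_chordS_mul_iteratedFDeriv (a : 𝓢(Phase n, ℂ)) {b : Phase n → ℂ}
    (hb : ContDiff ℝ ∞ b) (r : ℕ) (z : Phase n) :
    (((1 / Real.pi) ^ (2 * n) : ℝ) : ℂ) * ∫ w, Complex.exp (2 * Complex.I * (sympl z w : ℂ)) *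
      chordS a w * iteratedFDeriv ℝ r b z (fun _ => w) = (Complex.I / 2) ^ r * poissonPow r a b z := by
  induction r generalizing a b with
  | zero =>
    simp only [iteratedFDeriv_zero_apply, integral_mul_const, pow_zero, one_mul, poissonPow,
      Function.iterate_zero, id]
    rw [← mul_assoc, ← chordS_inversion]
  | succ r ih =>
    have e : ∀ w, Complex.exp (2 * Complex.I * (sympl z w : ℂ)) * chordS a w *
        iteratedFDeriv ℝ (r + 1) b z (fun _ => w) = ∑ i : Fin n, (Complex.I / 2) *
        (Complex.exp (2 * Complex.I * (sympl z w : ℂ)) * chordS (∂_{xDir i} a) w *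
          iteratedFDeriv ℝ r (dirD (pDir i) b) z (fun _ => w)
        - Complex.exp (2 * Complex.I * (sympl z w : ℂ)) * chordS (∂_{pDir i} a) w *
          iteratedFDeriv ℝ r (dirD (xDir i) b) z (fun _ => w)) := by
      intro w
      rw [iteratedFDeriv_succ_apply_const hb, Finset.mul_sum]
      refine Finset.sum_congr rfl fun i _ => ?_
      -- The multiplier `w.1 i` corresponds to the `pᵢ`-derivative of `a`, and `-w.2 i` to its
      -- `xᵢ`-derivative, each up to the factor `1/(2i) = -i/2`. The signs combine into `i/2` times
      -- the Poisson bracket.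
      rw [chordS_lineDeriv, chordS_lineDeriv, sympl_xDir, sympl_pDir]
      push_cast
      linear_combination (Complex.exp (2 * Complex.I * (sympl z w : ℂ)) * chordS a w *
        ((w.1 i : ℂ) * iteratedFDeriv ℝ r (dirD (xDir i) b) z (fun _ => w)
        + (w.2 i : ℂ) * iteratedFDeriv ℝ r (dirD (pDir i) b) z (fun _ => w))) * Complex.I_sq
    simp only [e]
    rw [integral_finsetSum]
    swap
    · intro i _
      exact ((integrable_chord_mul_iteratedFDeriv _ _ _ _).sub
        (integrable_chord_mul_iteratedFDeriv _ _ _ _)).const_mul _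
    rw [poissonPow_succ (a.smooth ⊤) hb, Finset.mul_sum, Finset.mul_sum]
    refine Finset.sum_congr rfl fun i _ => ?_
    rw [integral_const_mul, integral_sub (integrable_chord_mul_iteratedFDeriv _ _ _ _)
      (integrable_chord_mul_iteratedFDeriv _ _ _ _)]
    have i1 := ih (∂_{xDir i} a) (contDiff_dirD hb (pDir i))
    have i2 := ih (∂_{pDir i} a) (contDiff_dirD hb (xDir i))
    rw [coe_lineDeriv] at i1 i2
    rw [pow_succ]
    linear_combination (Complex.I / 2) * (i1 - i2)

/-- The semiclassical expansion of the Moyal product of a Schwartz function and a bounded smooth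
function. -/
theorem hasFormalSeries_moyal (a : 𝓢(Phase n, ℂ)) {b : Phase n → ℂ} (hb : ContDiff ℝ ∞ b) {M : ℝ}
    (hM : ∀ z, ‖b z‖ ≤ M) :
    HasFormalSeries (fun ε => moyal ε a b) (moyalSeries a b) := by
  intro K hK N
  obtain ⟨C, hC⟩ := exists_taylor_bound hb hM hK N
  -- The Taylor remainder at increment `ε • w` is at most `C * ε ^ N * ‖w‖ ^ N`; the moment is
  -- finite because `chordS a` is Schwartz.
  refine ⟨(1 / Real.pi) ^ (2 * n) * (C * ∫ w, ‖w‖ ^ N * ‖chordS a w‖), fun ε hε _ z hz => ?_⟩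
  have hint : Integrable fun w => Complex.exp (2 * Complex.I * (sympl z w : ℂ)) * chordS a w *
      b (z + ε • w) := by
    refine ((chordS a).integrable.norm.mul_const M).mono' ?_ ?_
    · refine Continuous.aestronglyMeasurable ?_
      have h1 : Continuous fun w : Phase n => sympl z w :=
        continuous_sympl continuous_const continuous_id
      have := (chordS a).continuous
      have := hb.continuous
      fun_prop
    · refine Eventually.of_forall fun w => ?_
      rw [norm_mul, norm_mul, norm_cexp_ofReal_mul_I, one_mul]
      gcongr
      exact hM _
  have hterm : ∀ r, (ε : ℂ) ^ r * PowerSeries.coeff r (moyalSeries a b) z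
      = (((1 / Real.pi) ^ (2 * n) : ℝ) : ℂ) * ∫ w, Complex.exp (2 * Complex.I * (sympl z w : ℂ)) *
        chordS a w * ((1 / (r.factorial : ℂ)) * iteratedFDeriv ℝ r b z (fun _ => ε • w)) := by
    intro r
    have e : ∀ w, Complex.exp (2 * Complex.I * (sympl z w : ℂ)) *
        chordS a w * ((1 / (r.factorial : ℂ)) * iteratedFDeriv ℝ r b z (fun _ => ε • w))
        = ((1 / (r.factorial : ℂ)) * (ε : ℂ) ^ r) *
          (Complex.exp (2 * Complex.I * (sympl z w : ℂ)) * chordS a w *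
            iteratedFDeriv ℝ r b z (fun _ => w)) := by
      intro w
      rw [ContinuousMultilinearMap.map_smul_univ]
      simp only [Finset.prod_const, Finset.card_univ, Fintype.card_fin, Complex.real_smul]
      push_cast
      ring
    simp only [e]
    rw [integral_const_mul]
    simp only [moyalSeries, PowerSeries.coeff_mk]
    linear_combination (-(1 / (r.factorial : ℂ)) * (ε : ℂ) ^ r) *
      integral_chordS_mul_iteratedFDeriv a hb r z
  have hint' : ∀ r, Integrable fun w => Complex.exp (2 * Complex.I * (sympl z w : ℂ)) *
        chordS a w * ((1 / (r.factorial : ℂ)) * iteratedFDeriv ℝ r b z (fun _ => ε • w)) := by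
    intro r
    refine ((integrable_chord_mul_iteratedFDeriv (chordS a) b r z).const_mul
      ((1 / (r.factorial : ℂ)) * (ε : ℂ) ^ r)).congr (Eventually.of_forall fun w => ?_)
    beta_reduce
    rw [ContinuousMultilinearMap.map_smul_univ]
    simp only [Finset.prod_const, Finset.card_univ, Fintype.card_fin, Complex.real_smul]
    push_cast
    ring
  beta_reduce
  rw [moyal_eq hε]
  simp only [hterm, ← chordS_apply]
  rw [← Finset.mul_sum, ← mul_sub, ← integral_finsetSum _ fun r _ => hint' r,
    ← integral_sub hint (integrable_finsetSum _ fun r _ => hint' r), norm_mul, Complex.norm_real,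
    Real.norm_of_nonneg (by positivity), mul_assoc]
  gcongr
  rw [mul_assoc, mul_comm _ (ε ^ N), ← mul_assoc, ← integral_const_mul]
  refine norm_integral_le_of_norm_le (((chordS a).integrable_pow_mul volume N).const_mul _)
    (Eventually.of_forall fun w => ?_)
  rw [← Finset.mul_sum, ← mul_sub, norm_mul, norm_mul, norm_cexp_ofReal_mul_I, one_mul]
  calc _ ≤ ‖chordS a w‖ * (C * ‖ε • w‖ ^ N) := by gcongr; exact hC z hz _
    _ = _ := by rw [norm_smul, Real.norm_of_nonneg hε.le]; ring

end Asymptotics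

/-! ### Almost everywhere Fourier inversion -/

section FourierInversion

open scoped FourierTransform SchwartzMap

/-- Fourier inversion almost everywhere, without continuity assumption. -/
theorem ae_eq_fourierInv_fourier {V : Type*} [NormedAddCommGroup V] [InnerProductSpace ℝ V]
    [FiniteDimensional ℝ V] [MeasurableSpace V] [BorelSpace V] {f : V → ℂ} (hf : Integrable f)
    (hf' : Integrable (𝓕 f)) : ∀ᵐ v, f v = 𝓕⁻ (𝓕 f) v := by
  have hcont : Continuous (𝓕⁻ (𝓕 f)) := by
    rw [Real.fourierInv_eq_fourier_comp_neg]
    exact VectorFourier.fourierIntegral_continuous Real.continuous_fourierChar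
      (by exact continuous_inner) hf'.comp_neg
  -- Tested against a smooth compactly supported function, the statement becomes inversion for
  -- Schwartz functions: both transforms are moved across the pairing.
  refine ae_eq_of_integral_contDiff_smul_eq hf.locallyIntegrable hcont.locallyIntegrable
    fun g hg hgs => ?_
  let g₀ : V → ℂ := fun v => (g v : ℂ)
  have hg₀ : ContDiff ℝ ∞ g₀ := Complex.ofRealCLM.contDiff.comp hg
  have hgs₀ : HasCompactSupport g₀ := hgs.comp_left (g := ((↑) : ℝ → ℂ)) rfl
  let γ : 𝓢(V, ℂ) := hgs₀.toSchwartzMap hg₀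
  have hγ : ∀ v, γ v = g v := fun v => rfl
  have e1 : ∫ x, (𝓕 (𝓕⁻ γ) : 𝓢(V, ℂ)) x • f x = ∫ x, (𝓕⁻ γ) x • 𝓕 f x := by
    have := VectorFourier.integral_fourierIntegral_smul_eq_flip (μ := volume) (ν := volume)
      (L := innerₗ V) Real.continuous_fourierChar continuous_inner (𝓕⁻ γ).integrable hf
    rw [flip_innerₗ] at this
    exact this
  have e2 : ∫ x, (𝓕⁻ γ) x • 𝓕 f x = ∫ x, γ x • 𝓕⁻ (𝓕 f) x := by
    have := VectorFourier.integral_fourierIntegral_smul_eq_flip (μ := volume) (ν := volume)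
      (L := -innerₗ V) Real.continuous_fourierChar
      (continuous_inner (𝕜 := ℝ) (E := V)).neg γ.integrable hf'
    rw [show (-innerₗ V).flip = -innerₗ V from
      LinearMap.ext₂ fun x y => by simp [real_inner_comm]] at this
    rw [SchwartzMap.fourierInv_coe]
    exact this
  rw [FourierTransform.fourier_fourierInv_eq] at e1
  simpa only [hγ, Complex.real_smul, smul_eq_mul] using e1.trans e2

variable {n : ℕ}

/-- The phase is `2⟨p, t⟩` instead of `2π⟨p, t⟩`; rescaling `p` by `π` produces the factor `πⁿ`. -/
theorem ae_eq_integral_cexp_of_integrable {f : Conf n → ℂ} (hf : Integrable f)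
    (hG : Integrable fun p : Conf n =>
      ∫ t, Complex.exp (-(2 * Complex.I * ((inner ℝ p t : ℝ) : ℂ))) * f t) :
    ∀ᵐ t, (Real.pi ^ n : ℝ) * f t = ∫ p : Conf n,
      Complex.exp (2 * Complex.I * ((inner ℝ p t : ℝ) : ℂ)) *
        ∫ t, Complex.exp (-(2 * Complex.I * ((inner ℝ p t : ℝ) : ℂ))) * f t := by
  have hpi : (Real.pi : ℂ) ≠ 0 := by exact_mod_cast Real.pi_ne_zero
  have e : ∀ p : Conf n, 𝓕 f (Real.pi⁻¹ • p)
      = ∫ t, Complex.exp (-(2 * Complex.I * ((inner ℝ p t : ℝ) : ℂ))) * f t := fun p => by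
    rw [Real.fourier_eq']
    congr 1
    funext t
    rw [smul_eq_mul, inner_smul_right, real_inner_comm]
    congr 2
    push_cast
    field_simp
  simp only [← e] at hG ⊢
  have hG' : Integrable (𝓕 f) :=
    (integrable_comp_smul_iff volume (𝓕 f) (inv_ne_zero Real.pi_ne_zero)).1 hG
  filter_upwards [ae_eq_fourierInv_fourier hf hG'] with t ht
  rw [ht, Real.fourierInv_eq']
  have := Measure.integral_comp_smul (volume : Measure (Conf n))
    (fun v => Complex.exp (↑(2 * Real.pi * inner ℝ v t) * Complex.I) • 𝓕 f v) Real.pi⁻¹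
  rw [finrank_euclideanSpace_fin, Complex.real_smul, abs_of_nonneg (by positivity), inv_pow,
    inv_inv] at this
  rw [← this]
  congr 1
  funext p
  rw [smul_eq_mul, real_inner_smul_left]
  congr 2
  push_cast
  field_simp

theorem ae_eq_integral_cexp_neg_of_integrable {f : Conf n → ℂ} (hf : Integrable f)
    (hG : Integrable fun p : Conf n =>
      ∫ t, Complex.exp (2 * Complex.I * ((inner ℝ t p : ℝ) : ℂ)) * f t) :
    ∀ᵐ t, (Real.pi ^ n : ℝ) * f t = ∫ p : Conf n,
      Complex.exp (-(2 * Complex.I * ((inner ℝ t p : ℝ) : ℂ))) *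
        ∫ t, Complex.exp (2 * Complex.I * ((inner ℝ t p : ℝ) : ℂ)) * f t := by
  have h := ae_eq_integral_cexp_of_integrable hf (by
    refine hG.comp_neg.congr (Eventually.of_forall fun p => ?_)
    simp only [inner_neg_right, real_inner_comm]
    push_cast
    simp)
  filter_upwards [h] with t ht
  rw [ht, ← integral_neg_eq_self]
  simp only [inner_neg_left, real_inner_comm]
  push_cast
  simp

end FourierInversion

/-! ### Products of affine pullbacks of square integrable functions -/

section SquareIntegrable

variable {n : ℕ}

theorem integrable_sq_norm (f : L2 n) : Integrable fun t => ‖f t‖ ^ 2 :=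
  (memLp_two_iff_integrable_sq_norm (Lp.aestronglyMeasurable f)).1 (Lp.memLp f)

theorem integral_sq_norm (f : L2 n) : ∫ t, ‖f t‖ ^ 2 = ‖f‖ ^ 2 := by
  have h := L2.inner_def (𝕜 := ℂ) f f
  rw [inner_self_eq_norm_sq_to_K] at h
  have : ∀ t, (inner ℂ (f t) (f t) : ℂ) = ((‖f t‖ ^ 2 : ℝ) : ℂ) := fun t => by
    rw [inner_self_eq_norm_sq_to_K]; norm_cast
  simp only [this] at h
  rw [integral_complex_ofReal] at h
  apply Complex.ofReal_injective
  rw [← h]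
  push_cast
  rfl

theorem integrable_sq_norm_affine (f : L2 n) (c : Conf n) {s : ℝ} (hs : s ≠ 0) :
    Integrable fun t => ‖f (c + s • t)‖ ^ 2 :=
  ((integrable_sq_norm f).comp_add_left c).comp_smul hs

theorem integral_sq_norm_affine (f : L2 n) (c : Conf n) (s : ℝ) :
    ∫ t, ‖f (c + s • t)‖ ^ 2 = |(s ^ n)⁻¹| * ‖f‖ ^ 2 := by
  rw [Measure.integral_comp_smul (volume : Measure (Conf n)) (fun t => ‖f (c + t)‖ ^ 2) s,
    finrank_euclideanSpace_fin, integral_add_left_eq_self (fun t => ‖f t‖ ^ 2), integral_sq_norm,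
    smul_eq_mul]

theorem measurable_coe (f : L2 n) : Measurable f := (Lp.stronglyMeasurable f).measurable

theorem norm_mul_conj_le (a b : ℂ) : ‖a * (starRingEnd ℂ) b‖ ≤ (‖a‖ ^ 2 + ‖b‖ ^ 2) / 2 := by
  rw [norm_mul, RCLike.norm_conj]
  nlinarith [sq_nonneg (‖a‖ - ‖b‖)]

theorem integrable_mul_conj_affine (f g : L2 n) (c c' : Conf n) {s s' : ℝ} (hs : s ≠ 0)
    (hs' : s' ≠ 0) :
    Integrable fun t => f (c + s • t) * (starRingEnd ℂ) (g (c' + s' • t)) := by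
  refine (((integrable_sq_norm_affine f c hs).add (integrable_sq_norm_affine g c' hs')).div_const
    2).mono' ?_ (Eventually.of_forall fun t => norm_mul_conj_le _ _)
  have := measurable_coe f
  have := measurable_coe g
  exact (by fun_prop : Measurable fun t =>
    f (c + s • t) * (starRingEnd ℂ) (g (c' + s' • t))).aestronglyMeasurable

theorem integral_norm_mul_conj_affine_le (f g : L2 n) (c c' : Conf n) {s s' : ℝ} (hs : s ≠ 0)
    (hs' : s' ≠ 0) :
    ∫ t, ‖f (c + s • t) * (starRingEnd ℂ) (g (c' + s' • t))‖
      ≤ (|(s ^ n)⁻¹| * ‖f‖ ^ 2 + |(s' ^ n)⁻¹| * ‖g‖ ^ 2) / 2 := by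
  rw [← integral_sq_norm_affine f c, ← integral_sq_norm_affine g c',
    ← integral_add (integrable_sq_norm_affine f c hs) (integrable_sq_norm_affine g c' hs'),
    ← integral_div]
  exact integral_mono (integrable_mul_conj_affine f g c c' hs hs').norm
    (((integrable_sq_norm_affine f c hs).add (integrable_sq_norm_affine g c' hs')).div_const 2)
    fun t => norm_mul_conj_le _ _

end SquareIntegrable

/-! ### Measurability and integrability of countable sums -/

section TsumIntegral

variable {ι T : Type*} [Countable ι] [MeasurableSpace T] {F : ι → T → ℂ}

/-- The sum is an integral against counting measure. Where the family is not summable, both take the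
default value `0`. -/
theorem measurable_tsum (hF : ∀ i, Measurable (F i)) : Measurable fun t => ∑' i, F i t := by
  let _ : MeasurableSpace ι := ⊤
  have h1 : Measurable (Function.uncurry fun (t : T) (i : ι) => F i t) :=
    measurable_from_prod_countable_left fun i => hF i
  have h2 := (h1.stronglyMeasurable.integral_prod_right (ν := Measure.count)).measurable
  convert h2 using 2 with t
  by_cases h : Summable fun i => F i t
  · rw [integral_countable (integrable_count_iff.2 h.norm)]
    simp [Measure.real]
  · rw [tsum_eq_zero_of_not_summable h, integral_undef (by rwa [integrable_count_iff, summable_norm_iff])]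

theorem integrable_tsum {μ : Measure T} (hF : ∀ i, Measurable (F i))
    (hint : ∀ i, Integrable (F i) μ) (hsum : Summable fun i => ∫ t, ‖F i t‖ ∂μ) :
    Integrable (fun t => ∑' i, F i t) μ := by
  refine ⟨(measurable_tsum hF).aestronglyMeasurable, ?_⟩
  refine lt_of_le_of_lt (lintegral_mono fun t => enorm_tsum_le_tsum_enorm) ?_
  rw [lintegral_tsum fun i => (hF i).enorm.aemeasurable]
  have : ∀ i, ∫⁻ t, ‖F i t‖ₑ ∂μ = ENNReal.ofReal (∫ t, ‖F i t‖ ∂μ) := fun i =>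
    (ofReal_integral_norm_eq_lintegral_enorm (hint i)).symm
  simp only [this]
  exact hsum.tsum_ofReal_lt_top

end TsumIntegral

/-! ### Reflections of phase space and the cross-Wigner transform -/

section Reflection

variable {n : ℕ}

/-- The unimodular number `exp(2ic)`. -/
noncomputable def ph (c : ℝ) : ℂ := Complex.exp (2 * Complex.I * (c : ℂ))

theorem ph_add (a b : ℝ) : ph (a + b) = ph a * ph b := by
  rw [ph, ph, ph, ← Complex.exp_add]; congr 1; push_cast; ring

theorem norm_ph (c : ℝ) : ‖ph c‖ = 1 := norm_cexp_ofReal_mul_I c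

theorem ph_neg (c : ℝ) : ph (-c) = Complex.exp (-(2 * Complex.I * (c : ℂ))) := by
  rw [ph]; congr 1; push_cast; ring

theorem conj_ph (c : ℝ) : (starRingEnd ℂ) (ph c) = ph (-c) := by
  rw [ph, ph, ← Complex.exp_conj]; congr 1; simp [Complex.conj_ofNat]

@[fun_prop] theorem contDiff_ph {m : WithTop ℕ∞} : ContDiff ℝ m ph := by
  unfold ph
  exact (contDiff_const.mul Complex.ofRealCLM.contDiff).cexp

@[fun_prop] theorem continuous_ph : Continuous ph := by unfold ph; fun_prop

@[fun_prop] theorem measurable_ph : Measurable ph := continuous_ph.measurable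

theorem integral_comp_affine (f : Conf n → ℂ) (c : Conf n) (s : ℝ) :
    ∫ t, f (c + s • t) = ((|(s ^ n)⁻¹| : ℝ) : ℂ) * ∫ t, f t := by
  rw [Measure.integral_comp_smul (volume : Measure (Conf n)) (fun t => f (c + t)) s,
    finrank_euclideanSpace_fin, integral_add_left_eq_self f, Complex.real_smul]

/-- A representative of the reflection of `φ` at the phase space point `z`. -/
noncomputable def reflectFun (hbar : ℝ) (z : Phase n) (φ : Conf n → ℂ) : Conf n → ℂ := fun t =>
  ph (-(inner ℝ z.2 (z.1 - t) / hbar)) * φ ((2 : ℝ) • z.1 - t)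

theorem measurable_reflectFun (hbar : ℝ) (z : Phase n) (φ : L2 n) :
    Measurable (reflectFun hbar z φ) := by
  have := measurable_coe φ
  unfold reflectFun
  fun_prop

theorem norm_reflectFun (hbar : ℝ) (z : Phase n) (φ : Conf n → ℂ) (t : Conf n) :
    ‖reflectFun hbar z φ t‖ = ‖φ ((2 : ℝ) • z.1 - t)‖ := by
  rw [reflectFun, norm_mul, norm_ph, one_mul]

theorem memLp_reflectFun (hbar : ℝ) (z : Phase n) (φ : L2 n) :
    MemLp (reflectFun hbar z φ) 2 := by
  rw [memLp_two_iff_integrable_sq_norm (measurable_reflectFun hbar z φ).aestronglyMeasurable]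
  simp only [norm_reflectFun]
  exact (integrable_sq_norm φ).comp_sub_left _

/-- The reflection of a square integrable function at a phase space point. -/
noncomputable def reflect (hbar : ℝ) (z : Phase n) (φ : L2 n) : L2 n :=
  (memLp_reflectFun hbar z φ).toLp _

theorem coeFn_reflect (hbar : ℝ) (z : Phase n) (φ : L2 n) :
    reflect hbar z φ =ᵐ[volume] reflectFun hbar z φ := MemLp.coeFn_toLp _

theorem norm_reflect (hbar : ℝ) (z : Phase n) (φ : L2 n) : ‖reflect hbar z φ‖ = ‖φ‖ := by
  have h : ‖reflect hbar z φ‖ ^ 2 = ‖φ‖ ^ 2 := by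
    rw [← integral_sq_norm, ← integral_sq_norm,
      ← integral_sub_left_eq_self (fun t => ‖φ t‖ ^ 2) volume ((2 : ℝ) • z.1)]
    refine integral_congr_ae ?_
    filter_upwards [coeFn_reflect hbar z φ] with t ht
    rw [ht, norm_reflectFun]
  exact (sq_eq_sq₀ (norm_nonneg _) (norm_nonneg _)).1 h

theorem inner_reflect_left (hbar : ℝ) (z : Phase n) (φ ψ : L2 n) :
    (inner ℂ (reflect hbar z φ) ψ : ℂ) = ∫ t, ph (inner ℝ z.2 (z.1 - t) / hbar) *
      (starRingEnd ℂ) (φ ((2 : ℝ) • z.1 - t)) * ψ t := by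
  rw [L2.inner_def]
  refine integral_congr_ae ?_
  filter_upwards [coeFn_reflect hbar z φ] with t ht
  rw [ht, RCLike.inner_apply, reflectFun, map_mul, conj_ph, neg_neg, mul_comm]

theorem inner_reflect_right (hbar : ℝ) (z : Phase n) (φ ψ : L2 n) :
    (inner ℂ φ (reflect hbar z ψ) : ℂ) = ∫ t, ph (-(inner ℝ z.2 (z.1 - t) / hbar)) *
      ψ ((2 : ℝ) • z.1 - t) * (starRingEnd ℂ) (φ t) := by
  rw [L2.inner_def]
  refine integral_congr_ae ?_
  filter_upwards [coeFn_reflect hbar z ψ] with t ht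
  rw [ht, RCLike.inner_apply, reflectFun]

/-- A reflection is self-adjoint, because `t ↦ 2x - t` is a measure preserving involution that
reverses the sign of the phase. -/
theorem inner_reflect_comm (hbar : ℝ) (z : Phase n) (φ ψ : L2 n) :
    (inner ℂ (reflect hbar z φ) ψ : ℂ) = inner ℂ φ (reflect hbar z ψ) := by
  rw [inner_reflect_left, inner_reflect_right,
    ← integral_sub_left_eq_self _ volume ((2 : ℝ) • z.1)]
  congr 1
  funext t
  rw [sub_sub_cancel, show z.1 - ((2 : ℝ) • z.1 - t) = -(z.1 - t) by module, inner_neg_right,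
    neg_div]
  ring

/-- The cross-Wigner transform as a matrix element of a reflection. -/
theorem crossWigner_eq_inner {hbar : ℝ} (hbar_pos : 0 < hbar) (ψ φ : L2 n) (z : Phase n) :
    crossWigner hbar ψ φ z = (((1 / (Real.pi * hbar)) ^ n : ℝ) : ℂ) *
      inner ℂ (reflect hbar z φ) ψ := by
  have hh : (hbar : ℂ) ≠ 0 := by exact_mod_cast hbar_pos.ne'
  rw [crossWigner, inner_reflect_left]
  set F : Conf n → ℂ := fun y => Complex.exp (-(Complex.I / (hbar : ℂ)) * ((inner ℝ z.2 y : ℝ) : ℂ)) *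
      ψ (z.1 + (1 / 2 : ℝ) • y) * (starRingEnd ℂ) (φ (z.1 - (1 / 2 : ℝ) • y)) with hF
  have e : ∀ t, F (-((2 : ℝ) • z.1) + (2 : ℝ) • t) = ph (inner ℝ z.2 (z.1 - t) / hbar) *
      (starRingEnd ℂ) (φ ((2 : ℝ) • z.1 - t)) * ψ t := by
    intro t
    simp only [hF]
    rw [show z.1 + (1 / 2 : ℝ) • (-((2 : ℝ) • z.1) + (2 : ℝ) • t) = t by module,
      show z.1 - (1 / 2 : ℝ) • (-((2 : ℝ) • z.1) + (2 : ℝ) • t) = (2 : ℝ) • z.1 - t by module,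
      show -((2 : ℝ) • z.1) + (2 : ℝ) • t = (-2 : ℝ) • (z.1 - t) by module, inner_smul_right, ph]
    rw [mul_right_comm]
    congr 3
    push_cast
    field_simp
  have := integral_comp_affine F (-((2 : ℝ) • z.1)) 2
  simp only [e] at this
  rw [this, ← mul_assoc]
  congr 1
  rw [abs_of_nonneg (by positivity), ← Complex.ofReal_mul, ← inv_pow, ← mul_pow]
  congr 2
  field_simp

theorem crossWigner_eq_inner' {hbar : ℝ} (hbar_pos : 0 < hbar) (ψ φ : L2 n) (z : Phase n) :
    crossWigner hbar ψ φ z = (((1 / (Real.pi * hbar)) ^ n : ℝ) : ℂ) *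
      inner ℂ φ (reflect hbar z ψ) := by
  rw [crossWigner_eq_inner hbar_pos, inner_reflect_comm]

theorem norm_crossWigner_le {hbar : ℝ} (hbar_pos : 0 < hbar) (ψ φ : L2 n) (z : Phase n) :
    ‖crossWigner hbar ψ φ z‖ ≤ (1 / (Real.pi * hbar)) ^ n * (‖φ‖ * ‖ψ‖) := by
  rw [crossWigner_eq_inner hbar_pos, norm_mul, Complex.norm_real,
    Real.norm_of_nonneg (by positivity)]
  gcongr
  exact (norm_inner_le_norm _ _).trans_eq (by rw [norm_reflect])

/-- The variable `η = y / (2ħ)` removes `ħ` from the phase, so the partial Fourier transform can be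
inverted with the phase `2⟨p, η⟩`. -/
theorem crossWigner_eq_integral {hbar : ℝ} (hbar_pos : 0 < hbar) (ψ φ : L2 n) (z : Phase n) :
    crossWigner hbar ψ φ z = (((1 / Real.pi) ^ n : ℝ) : ℂ) * ∫ η : Conf n,
      ph (-(inner ℝ z.2 η)) * (ψ (z.1 + hbar • η) * (starRingEnd ℂ) (φ (z.1 + (-hbar) • η))) := by
  have hh : (hbar : ℂ) ≠ 0 := by exact_mod_cast hbar_pos.ne'
  rw [crossWigner]
  set F : Conf n → ℂ := fun y => Complex.exp (-(Complex.I / (hbar : ℂ)) * ((inner ℝ z.2 y : ℝ) : ℂ)) *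
      ψ (z.1 + (1 / 2 : ℝ) • y) * (starRingEnd ℂ) (φ (z.1 - (1 / 2 : ℝ) • y)) with hF
  have e : ∀ η, F (0 + (2 * hbar) • η) = ph (-(inner ℝ z.2 η)) *
      (ψ (z.1 + hbar • η) * (starRingEnd ℂ) (φ (z.1 + (-hbar) • η))) := by
    intro η
    simp only [hF]
    rw [show z.1 + (1 / 2 : ℝ) • (0 + (2 * hbar) • η) = z.1 + hbar • η by module,
      show z.1 - (1 / 2 : ℝ) • (0 + (2 * hbar) • η) = z.1 + (-hbar) • η by module, zero_add,
      inner_smul_right, ph, mul_assoc]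
    congr 2
    push_cast
    field_simp
  have := integral_comp_affine F 0 (2 * hbar)
  simp only [e] at this
  rw [this, ← mul_assoc]
  congr 1
  rw [abs_of_nonneg (by positivity), ← Complex.ofReal_mul, ← inv_pow, ← mul_pow]
  congr 2
  field_simp

/-- Two reflections compose to a displacement up to a phase. The variable `m = x + x' - t` makes the
two shifts opposite, and the part of the phase depending on `m` involves only `p - p'`. -/
theorem inner_reflect_reflect (hbar : ℝ) (z z' : Phase n) (φ ψ : L2 n) :
    (inner ℂ (reflect hbar z φ) (reflect hbar z' ψ) : ℂ) = ph (sympl z' z / hbar) *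
      ∫ m, ph (inner ℝ (z.2 - z'.2) m / hbar) *
        (ψ (m + (z'.1 - z.1)) * (starRingEnd ℂ) (φ (m - (z'.1 - z.1)))) := by
  rw [inner_reflect_left, ← integral_const_mul,
    ← integral_sub_left_eq_self _ volume (z.1 + z'.1)]
  have h1 : (fun t => ph (inner ℝ z.2 (z.1 - t) / hbar) *
      (starRingEnd ℂ) (φ ((2 : ℝ) • z.1 - t)) * reflect hbar z' ψ t) =ᵐ[volume]
      fun t => ph (inner ℝ z.2 (z.1 - t) / hbar) *
      (starRingEnd ℂ) (φ ((2 : ℝ) • z.1 - t)) * reflectFun hbar z' ψ t := by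
    filter_upwards [coeFn_reflect hbar z' ψ] with t ht
    rw [ht]
  rw [integral_sub_left_eq_self (fun t => ph (inner ℝ z.2 (z.1 - t) / hbar) *
      (starRingEnd ℂ) (φ ((2 : ℝ) • z.1 - t)) * reflect hbar z' ψ t), integral_congr_ae h1,
    ← integral_sub_left_eq_self _ volume (z.1 + z'.1)]
  congr 1
  funext m
  rw [reflectFun, show z.1 - (z.1 + z'.1 - m) = m - z'.1 by abel,
    show (2 : ℝ) • z.1 - (z.1 + z'.1 - m) = m - (z'.1 - z.1) by module,
    show z'.1 - (z.1 + z'.1 - m) = m - z.1 by abel,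
    show (2 : ℝ) • z'.1 - (z.1 + z'.1 - m) = m + (z'.1 - z.1) by module]
  have e : ph (inner ℝ z.2 (m - z'.1) / hbar) * ph (-(inner ℝ z'.2 (m - z.1) / hbar))
      = ph (sympl z' z / hbar) * ph (inner ℝ (z.2 - z'.2) m / hbar) := by
    rw [← ph_add, ← ph_add]
    congr 1
    simp only [sympl, inner_sub_left, inner_sub_right]
    rw [real_inner_comm z.2 z'.1]
    ring
  linear_combination (ψ (m + (z'.1 - z.1)) * (starRingEnd ℂ) (φ (m - (z'.1 - z.1)))) * e

/-- After the shift `t = s + 2ħ w.1` all dependence on `z` sits in `reflect hbar z φ`; the remaining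
factors come from an operator on `ψ` depending only on `w`. -/
theorem ph_sympl_mul_crossWigner {hbar : ℝ} (hbar_pos : 0 < hbar) (ψ φ : L2 n) (z w : Phase n) :
    ph (sympl z w) * crossWigner hbar ψ φ (z + hbar • w) = (((1 / (Real.pi * hbar)) ^ n : ℝ) : ℂ) *
      ∫ s, ph (-(inner ℝ w.2 (s + hbar • w.1))) *
        ((starRingEnd ℂ) (reflect hbar z φ s) * ψ (s + (2 * hbar) • w.1)) := by
  rw [crossWigner_eq_inner hbar_pos, inner_reflect_left, mul_left_comm, ← integral_const_mul,
    ← integral_add_right_eq_self _ ((2 * hbar) • w.1)]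
  congr 1
  refine integral_congr_ae ?_
  filter_upwards [coeFn_reflect hbar z φ] with s hs
  rw [hs, reflectFun, map_mul, conj_ph, neg_neg]
  simp only [Prod.fst_add, Prod.snd_add, Prod.smul_fst, Prod.smul_snd]
  rw [show (2 : ℝ) • (z.1 + hbar • w.1) - (s + (2 * hbar) • w.1) = (2 : ℝ) • z.1 - s by module,
    show z.1 + hbar • w.1 - (s + (2 * hbar) • w.1) = z.1 - s - hbar • w.1 by module]
  have e : ph (sympl z w) * ph (inner ℝ (z.2 + hbar • w.2) (z.1 - s - hbar • w.1) / hbar)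
      = ph (-(inner ℝ w.2 (s + hbar • w.1))) * ph (inner ℝ z.2 (z.1 - s) / hbar) := by
    rw [← ph_add, ← ph_add]
    congr 1
    simp only [sympl, inner_sub_right, inner_add_left, inner_add_right, inner_smul_right,
      real_inner_smul_left]
    rw [real_inner_comm w.2 z.1]
    field_simp
    ring
  linear_combination ((starRingEnd ℂ) (φ ((2 : ℝ) • z.1 - s)) * ψ (s + (2 * hbar) • w.1)) * e

/-- Composition with `t ↦ 2x - t` is continuous in `x` on `L²`; the factor of the phase depending on
`t` is absorbed into `g`. This later upgrades an almost everywhere identity to every point. -/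
theorem continuous_inner_reflect (hbar : ℝ) (g ψ : L2 n) (p : Conf n) :
    Continuous fun x : Conf n => (inner ℂ g (reflect hbar (x, p) ψ) : ℂ) := by
  have hm : MemLp (fun t => ph (-(inner ℝ p t / hbar)) * g t) 2 := by
    refine (Lp.memLp g).congr_norm ?_ (Eventually.of_forall fun t => by
      rw [norm_mul, norm_ph, one_mul])
    have := measurable_coe g
    exact Measurable.aestronglyMeasurable (by fun_prop)
  let T : Conf n → C(Conf n, Conf n) := fun x => ⟨fun t => (2 : ℝ) • x - t, by fun_prop⟩
  have hT : Continuous T := by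
    refine ContinuousMap.continuous_of_continuous_uncurry _ ?_
    change Continuous fun q : Conf n × Conf n => (2 : ℝ) • q.1 - q.2
    fun_prop
  have hmp : ∀ x, MeasurePreserving (T x) volume volume := fun x =>
    Measure.measurePreserving_sub_left volume _
  have hc := Continuous.compMeasurePreservingLp (f := fun _ : Conf n => ψ) continuous_const hT hmp
    (by simp)
  have e : ∀ x : Conf n, (inner ℂ g (reflect hbar (x, p) ψ) : ℂ) = ph (-(inner ℝ p x / hbar)) *
      inner ℂ (hm.toLp _) (Lp.compMeasurePreserving (T x) (hmp x) ψ) := by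
    intro x
    rw [inner_reflect_right, L2.inner_def, ← integral_const_mul]
    refine integral_congr_ae ?_
    filter_upwards [hm.coeFn_toLp, Lp.coeFn_compMeasurePreserving ψ (hmp x)] with t h1 h2
    rw [h1, h2, RCLike.inner_apply, map_mul, conj_ph, neg_neg]
    simp only [Function.comp_apply, T, ContinuousMap.coe_mk]
    rw [show -(inner ℝ p (x - t) / hbar) = -(inner ℝ p x / hbar) + inner ℝ p t / hbar by
      rw [inner_sub_right]; ring, ph_add]
    ring
  simp only [e]
  have h1 : Continuous fun x : Conf n => ph (-(inner ℝ p x / hbar)) := by fun_prop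
  exact h1.mul (continuous_const.inner hc)

end Reflection

/-! ### Integral kernel of the density operator and the Gram kernel -/

section Mixture

variable {n : ℕ} {ι : Type*}

/-- A term of the integral kernel of a density operator, in the coordinates `(x + ħη, x - ħη)`. -/
noncomputable def mixTerm (hbar : ℝ) (lam : ι → ℝ) (ψs : ι → L2 n) (j : ι) (q : Phase n) : ℂ :=
  (lam j : ℂ) * (ψs j (q.1 + hbar • q.2) * (starRingEnd ℂ) (ψs j (q.1 + (-hbar) • q.2)))

/-- The integral kernel of a density operator, in the coordinates `(x + ħη, x - ħη)`. -/
noncomputable def mixKernel (hbar : ℝ) (lam : ι → ℝ) (ψs : ι → L2 n) (q : Phase n) : ℂ :=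
  ∑' j, mixTerm hbar lam ψs j q

theorem measurable_mixTerm (hbar : ℝ) (lam : ι → ℝ) (ψs : ι → L2 n) (j : ι) :
    Measurable (mixTerm hbar lam ψs j) := by
  have := measurable_coe (ψs j)
  unfold mixTerm
  fun_prop

theorem measurable_mixKernel [Countable ι] (hbar : ℝ) (lam : ι → ℝ) (ψs : ι → L2 n) :
    Measurable (mixKernel hbar lam ψs) :=
  measurable_tsum (measurable_mixTerm hbar lam ψs)

section Bounds

variable {hbar : ℝ} {lam : ι → ℝ} {ψs : ι → L2 n}

theorem integrable_mixTerm_right (hbar_pos : 0 < hbar) (j : ι) (x : Conf n) :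
    Integrable fun η => mixTerm hbar lam ψs j (x, η) :=
  (integrable_mul_conj_affine _ _ x x hbar_pos.ne' (neg_ne_zero.2 hbar_pos.ne')).const_mul _

theorem integrable_mixTerm_left (j : ι) (η : Conf n) :
    Integrable fun x => mixTerm hbar lam ψs j (x, η) := by
  have := (integrable_mul_conj_affine (ψs j) (ψs j) (hbar • η) ((-hbar) • η) one_ne_zero
    one_ne_zero).const_mul (lam j : ℂ)
  simpa only [mixTerm, one_smul, add_comm] using this

theorem summable_mixTerm_right (hbar_pos : 0 < hbar) (h0 : ∀ j, 0 ≤ lam j) (hs : Summable lam)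
    (hn : ∀ j, ‖ψs j‖ = 1) (x : Conf n) :
    Summable fun j => ∫ η, ‖mixTerm hbar lam ψs j (x, η)‖ := by
  refine Summable.of_nonneg_of_le (fun j => integral_nonneg fun _ => norm_nonneg _) (fun j => ?_)
    (hs.mul_right ((|(hbar ^ n)⁻¹| + |((-hbar) ^ n)⁻¹|) / 2))
  simp only [mixTerm, norm_mul (lam j : ℂ), Complex.norm_real, Real.norm_of_nonneg (h0 j)]
  rw [integral_const_mul]
  refine mul_le_mul_of_nonneg_left ?_ (h0 j)
  simpa [hn] using integral_norm_mul_conj_affine_le (ψs j) (ψs j) x x hbar_pos.ne'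
    (neg_ne_zero.2 hbar_pos.ne')

theorem summable_mixTerm_left (h0 : ∀ j, 0 ≤ lam j) (hs : Summable lam)
    (hn : ∀ j, ‖ψs j‖ = 1) (η : Conf n) :
    Summable fun j => ∫ x, ‖mixTerm hbar lam ψs j (x, η)‖ := by
  refine Summable.of_nonneg_of_le (fun j => integral_nonneg fun _ => norm_nonneg _) (fun j => ?_) hs
  simp only [mixTerm, norm_mul (lam j : ℂ), Complex.norm_real, Real.norm_of_nonneg (h0 j)]
  rw [integral_const_mul]
  have := integral_norm_mul_conj_affine_le (ψs j) (ψs j) (hbar • η) ((-hbar) • η) one_ne_zero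
    one_ne_zero
  simp only [one_smul, hn] at this
  refine mul_le_of_le_one_right (h0 j) ?_
  simpa [add_comm] using this

theorem norm_ph_mul (c : ℝ) (a : ℂ) : ‖ph c * a‖ = ‖a‖ := by rw [norm_mul, norm_ph, one_mul]

theorem integrable_ph_mul {T : Type*} [MeasurableSpace T] {μ : Measure T} {f : T → ℂ}
    (hf : Integrable f μ) {c : T → ℝ} (hc : Measurable c) : Integrable (fun t => ph (c t) * f t) μ :=
  hf.norm.mono' ((measurable_ph.comp hc).aestronglyMeasurable.mul hf.aestronglyMeasurable)
    (Eventually.of_forall fun _ => (norm_ph_mul _ _).le)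

variable [Countable ι]

theorem integrable_mixKernel_right (hbar_pos : 0 < hbar) (h0 : ∀ j, 0 ≤ lam j) (hs : Summable lam)
    (hn : ∀ j, ‖ψs j‖ = 1) (x : Conf n) :
    Integrable fun η => mixKernel hbar lam ψs (x, η) :=
  integrable_tsum (fun j => (measurable_mixTerm hbar lam ψs j).comp measurable_prodMk_left)
    (fun j => integrable_mixTerm_right hbar_pos j x) (summable_mixTerm_right hbar_pos h0 hs hn x)

/-- The Wigner distribution as a Fourier transform of the integral kernel. -/
theorem wignerDist_eq_integral (hbar_pos : 0 < hbar) (h0 : ∀ j, 0 ≤ lam j) (hs : Summable lam)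
    (hn : ∀ j, ‖ψs j‖ = 1) (z : Phase n) :
    wignerDist hbar lam ψs z = (((1 / Real.pi) ^ n : ℝ) : ℂ) *
      ∫ η, ph (-(inner ℝ z.2 η)) * mixKernel hbar lam ψs (z.1, η) := by
  have h := hasSum_integral_of_summable_integral_norm
    (F := fun j η => ph (-(inner ℝ z.2 η)) * mixTerm hbar lam ψs j (z.1, η)) (μ := volume)
    (fun j => integrable_ph_mul (integrable_mixTerm_right hbar_pos j z.1) (by fun_prop))
    (by simpa only [norm_ph_mul] using summable_mixTerm_right hbar_pos h0 hs hn z.1)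
  simp only [tsum_mul_left] at h
  rw [wignerDist]
  refine ((h.mul_left (((1 / Real.pi) ^ n : ℝ) : ℂ)).congr_fun ?_).tsum_eq
  intro j
  rw [crossWigner_eq_integral hbar_pos, mul_left_comm, ← integral_const_mul]
  congr 2
  funext η
  simp only [mixTerm]
  ring

end Bounds

section KernelOfSymbol

variable {ρ : Phase n → ℂ}

/-- The Fourier transform with respect to the momentum. -/
noncomputable def momFT (ρ : Phase n → ℂ) (q : Phase n) : ℂ := ∫ p, ph (inner ℝ p q.2) * ρ (q.1, p)

theorem measurable_momFT (hρ : Measurable ρ) : Measurable (momFT ρ) := by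
  have : Measurable (Function.uncurry fun (q : Phase n) (p : Conf n) =>
      ph (inner ℝ p q.2) * ρ (q.1, p)) := by
    have h1 : Measurable fun r : Phase n × Conf n => ρ (r.1.1, r.2) := hρ.comp (by fun_prop)
    have h2 : Measurable fun r : Phase n × Conf n => ph (inner ℝ r.2 r.1.2) := by fun_prop
    exact h2.mul h1
  exact (this.stronglyMeasurable.integral_prod_right (ν := volume)).measurable

/-- Fubini, with momentum integrated first. The sign in `-w.1` comes from `-σ(u,w) = x·w.2 - p·w.1`.
-/
theorem chordFT_eq_integral_momFT (hρ : Integrable ρ) (w : Phase n) :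
    chordFT ρ w = ∫ x, ph (inner ℝ x w.2) * momFT ρ (x, -w.1) := by
  have e : chordFT ρ w = ∫ u : Phase n, ph (-(sympl u w)) * ρ u := by
    simp only [chordFT, ph_neg]
  have hc : Measurable fun u : Phase n => -(sympl u w) :=
    (continuous_sympl continuous_id continuous_const).neg.measurable
  rw [e, Measure.volume_eq_prod, integral_prod _ (integrable_ph_mul hρ hc)]
  congr 1
  funext x
  rw [momFT, ← integral_const_mul]
  congr 1
  funext p
  rw [← mul_assoc, ← ph_add]
  congr 2
  simp only [sympl, inner_neg_right]
  ring

theorem integrable_momFT_left (hρm : Measurable ρ) (hρ : Integrable ρ) (η : Conf n) :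
    Integrable fun x => momFT ρ (x, η) := by
  have h := (show Integrable ρ (Measure.prod volume volume) from hρ).integral_norm_prod_left
  refine h.mono' ((measurable_momFT hρm).comp measurable_prodMk_right).aestronglyMeasurable
    (Eventually.of_forall fun x => ?_)
  refine (norm_integral_le_integral_norm _).trans_eq ?_
  simp only [norm_ph_mul]

variable {hbar : ℝ} {lam : ι → ℝ} {ψs : ι → L2 n} [Countable ι]

/-- The integral kernel of a density operator with integrable Wigner distribution. -/
theorem mixKernel_ae_eq (hbar_pos : 0 < hbar) (h0 : ∀ j, 0 ≤ lam j) (hs : Summable lam)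
    (hn : ∀ j, ‖ψs j‖ = 1) (hρm : Measurable (wignerDist hbar lam ψs))
    (hρ : Integrable (wignerDist hbar lam ψs)) :
    ∀ᵐ η, ∀ᵐ x, mixKernel hbar lam ψs (x, η) = momFT (wignerDist hbar lam ψs) (x, η) := by
  have hms : MeasurableSet {q : Phase n |
      mixKernel hbar lam ψs (q.1, q.2) = momFT (wignerDist hbar lam ψs) (q.1, q.2)} :=
    measurableSet_eq_fun (measurable_mixKernel hbar lam ψs) (measurable_momFT hρm)
  -- Inversion is performed in `η` for almost every fixed `x`, whereas the kernel is later used at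
  -- almost every fixed `η`; joint measurability allows the exchange.
  rw [← Measure.ae_ae_comm hms]
  have h := (show Integrable (wignerDist hbar lam ψs) (Measure.prod volume volume) from
    hρ).prod_right_ae
  have hpi : ((Real.pi ^ n : ℝ) : ℂ) ≠ 0 := by
    exact_mod_cast pow_ne_zero n Real.pi_ne_zero
  filter_upwards [h] with x hx
  have e : ∀ p : Conf n, ∫ η, Complex.exp (-(2 * Complex.I * ((inner ℝ p η : ℝ) : ℂ))) *
      mixKernel hbar lam ψs (x, η) = ((Real.pi ^ n : ℝ) : ℂ) * wignerDist hbar lam ψs (x, p) := by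
    intro p
    rw [wignerDist_eq_integral hbar_pos h0 hs hn, ← mul_assoc, ← Complex.ofReal_mul, ← mul_pow,
      mul_one_div_cancel Real.pi_ne_zero, one_pow, Complex.ofReal_one, one_mul]
    simp only [ph_neg]
  have := ae_eq_integral_cexp_of_integrable (integrable_mixKernel_right hbar_pos h0 hs hn x)
    (by simp only [e]; exact hx.const_mul _)
  filter_upwards [this] with η hη
  simp only [e] at hη
  apply mul_left_cancel₀ hpi
  rw [hη, momFT, ← integral_const_mul]
  congr 1
  funext p
  rw [ph]
  ring

/-- The Gram kernel of the family of reflected states. -/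
theorem hasSum_inner_reflect (hbar_pos : 0 < hbar) (h0 : ∀ j, 0 ≤ lam j) (hs : Summable lam)
    (hn : ∀ j, ‖ψs j‖ = 1) (hρm : Measurable (wignerDist hbar lam ψs))
    (hρ : Integrable (wignerDist hbar lam ψs)) (hA : Continuous (chordFT (wignerDist hbar lam ψs)))
    (z z' : Phase n) :
    HasSum (fun j => (lam j : ℂ) *
        inner ℂ (reflect hbar z (ψs j)) (reflect hbar z' (ψs j)))
      (ph (sympl z' z / hbar) * chordFT (wignerDist hbar lam ψs) (hbar⁻¹ • (z - z'))) := by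
  have hbar_ne : hbar ≠ 0 := hbar_pos.ne'
  obtain ⟨x, p⟩ := z
  obtain ⟨x', p'⟩ := z'
  -- With `x' = x + ħη`, the series is a Fourier transform of the kernel in its first variable, for
  -- every `η`. Replacing the kernel by `momFT` is legitimate only for almost every `η`, and
  -- continuity in `η` of both sides removes the exception.
  have hA' : ∀ η : Conf n, HasSum (fun j => (lam j : ℂ) *
        inner ℂ (reflect hbar (x, p) (ψs j)) (reflect hbar (x + hbar • η, p') (ψs j)))
      (ph (sympl (x + hbar • η, p') (x, p) / hbar) *
        ∫ m, ph (inner ℝ (p - p') m / hbar) * mixKernel hbar lam ψs (m, η)) := by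
    intro η
    have h := hasSum_integral_of_summable_integral_norm
      (F := fun j m => ph (inner ℝ (p - p') m / hbar) * mixTerm hbar lam ψs j (m, η)) (μ := volume)
      (fun j => integrable_ph_mul (integrable_mixTerm_left j η) (by fun_prop))
      (by simpa only [norm_ph_mul] using summable_mixTerm_left h0 hs hn η)
    simp only [tsum_mul_left] at h
    refine (h.mul_left (ph (sympl (x + hbar • η, p') (x, p) / hbar))).congr_fun fun j => ?_
    rw [inner_reflect_reflect, mul_left_comm, ← integral_const_mul]
    congr 2
    funext m
    simp only [mixTerm, add_sub_cancel_left]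
    rw [neg_smul, ← sub_eq_add_neg]
    ring
  have hc1 : Continuous fun η : Conf n => ∑' j, (lam j : ℂ) *
      inner ℂ (reflect hbar (x, p) (ψs j)) (reflect hbar (x + hbar • η, p') (ψs j)) := by
    refine continuous_tsum (fun j => continuous_const.mul
      ((continuous_inner_reflect hbar _ (ψs j) p').comp (f := fun η : Conf n => x + hbar • η)
        (by fun_prop))) hs fun j η => ?_
    rw [norm_mul, Complex.norm_real, Real.norm_of_nonneg (h0 j)]
    refine mul_le_of_le_one_right (h0 j) ((norm_inner_le_norm _ _).trans_eq ?_)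
    rw [norm_reflect, norm_reflect, hn, one_mul]
  have hc2 : Continuous fun η : Conf n => ph (sympl (x + hbar • η, p') (x, p) / hbar) *
      chordFT (wignerDist hbar lam ψs) (-η, hbar⁻¹ • (p - p')) := by
    have : Continuous fun η : Conf n => sympl (x + hbar • η, p') (x, p) :=
      continuous_sympl (by fun_prop) continuous_const
    refine (continuous_ph.comp (this.div_const _)).mul
      (hA.comp (f := fun η : Conf n => ((-η, hbar⁻¹ • (p - p')) : Phase n)) (by fun_prop))
  have hae : ∀ᵐ η : Conf n, (∑' j, (lam j : ℂ) *
      inner ℂ (reflect hbar (x, p) (ψs j)) (reflect hbar (x + hbar • η, p') (ψs j)))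
      = ph (sympl (x + hbar • η, p') (x, p) / hbar) *
        chordFT (wignerDist hbar lam ψs) (-η, hbar⁻¹ • (p - p')) := by
    filter_upwards [mixKernel_ae_eq hbar_pos h0 hs hn hρm hρ] with η hη
    rw [(hA' η).tsum_eq, chordFT_eq_integral_momFT hρ]
    congr 1
    refine integral_congr_ae ?_
    filter_upwards [hη] with m hm
    rw [hm]
    simp only [neg_neg, inner_smul_right]
    rw [real_inner_comm m, div_eq_inv_mul]
  have heq := Continuous.ae_eq_iff_eq volume hc1 hc2 |>.1 hae
  have h := congrFun heq (hbar⁻¹ • (x' - x))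
  beta_reduce at h
  have e : x + hbar • hbar⁻¹ • (x' - x) = x' := by
    rw [smul_smul, mul_inv_cancel₀ hbar_ne, one_smul]; abel
  rw [e] at h
  have e' : hbar⁻¹ • (((x, p) : Phase n) - (x', p')) = (-(hbar⁻¹ • (x' - x)), hbar⁻¹ • (p - p')) := by
    rw [Prod.mk_sub_mk, Prod.smul_mk, ← smul_neg, neg_sub]
  rw [e', ← h]
  have hsum := (hA' (hbar⁻¹ • (x' - x))).summable
  rw [e] at hsum
  exact hsum.hasSum

end KernelOfSymbol

end Mixture

/-! ### The Moyal product with `ρ` as the action of the density operator -/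

section MoyalMixture

variable {n : ℕ} {ι : Type*}

theorem integral_comp_affine_smul {E : Type*} [NormedAddCommGroup E] [NormedSpace ℝ E]
    (f : Conf n → E) (c : Conf n) (s : ℝ) :
    ∫ t, f (c + s • t) = |(s ^ n)⁻¹| • ∫ t, f t := by
  rw [Measure.integral_comp_smul (volume : Measure (Conf n)) (fun t => f (c + t)) s,
    finrank_euclideanSpace_fin, integral_add_left_eq_self f]

section Shear

variable {h₁ h₂ : Conf n → ℂ} {c : ℝ}

theorem integrable_mul_shear (hm₁ : Measurable h₁) (hm₂ : Measurable h₂) (hi₁ : Integrable h₁)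
    (hi₂ : Integrable h₂) (hc : c ≠ 0) :
    Integrable (fun q : Phase n => h₁ q.2 * h₂ (q.2 + c • q.1)) := by
  rw [Measure.volume_eq_prod, integrable_prod_iff']
  · refine ⟨Eventually.of_forall fun s => ?_, ?_⟩
    · exact ((hi₂.comp_add_left s).comp_smul hc).const_mul (h₁ s)
    simp only [norm_mul]
    have : ∀ s, ∫ η, ‖h₁ s‖ * ‖h₂ (s + c • η)‖ = ‖h₁ s‖ * (|(c ^ n)⁻¹| • ∫ t, ‖h₂ t‖) := fun s => by
      rw [integral_const_mul, integral_comp_affine_smul (fun t => ‖h₂ t‖)]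
    simp only [this]
    exact hi₁.norm.mul_const _
  · exact Measurable.aestronglyMeasurable (by fun_prop)

/-- For fixed `q.2` an affine substitution in `q.1` decouples the two factors. Applied to the terms
of the mixture, it produces the product `⟨g, ψⱼ⟩⟨ψⱼ, ψ⟩`. -/
theorem integral_mul_shear (hm₁ : Measurable h₁) (hm₂ : Measurable h₂) (hi₁ : Integrable h₁)
    (hi₂ : Integrable h₂) (hc : c ≠ 0) :
    ∫ q : Phase n, h₁ q.2 * h₂ (q.2 + c • q.1)
      = ((|(c ^ n)⁻¹| : ℝ) : ℂ) * ((∫ t, h₁ t) * ∫ t, h₂ t) := by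
  have hi := integrable_mul_shear hm₁ hm₂ hi₁ hi₂ hc
  rw [Measure.volume_eq_prod] at hi ⊢
  rw [integral_prod_symm _ hi]
  simp only [integral_const_mul, integral_comp_affine]
  rw [integral_mul_const]
  ring

theorem integral_norm_mul_shear (hm₁ : Measurable h₁) (hm₂ : Measurable h₂) (hi₁ : Integrable h₁)
    (hi₂ : Integrable h₂) (hc : c ≠ 0) :
    ∫ q : Phase n, ‖h₁ q.2 * h₂ (q.2 + c • q.1)‖
      = |(c ^ n)⁻¹| * ((∫ t, ‖h₁ t‖) * ∫ t, ‖h₂ t‖) := by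
  have := integral_mul_shear (h₁ := fun t => ((‖h₁ t‖ : ℝ) : ℂ)) (h₂ := fun t => ((‖h₂ t‖ : ℝ) : ℂ))
    (by fun_prop) (by fun_prop) hi₁.norm.ofReal hi₂.norm.ofReal hc
  simp only [← Complex.ofReal_mul, ← norm_mul, integral_complex_ofReal] at this
  exact_mod_cast this

end Shear

theorem integrable_mul_conj (f g : L2 n) : Integrable fun t => f t * (starRingEnd ℂ) (g t) := by
  simpa using integrable_mul_conj_affine f g 0 0 one_ne_zero one_ne_zero

theorem integral_norm_mul_conj_le (f g : L2 n) :
    ∫ t, ‖f t * (starRingEnd ℂ) (g t)‖ ≤ (‖f‖ ^ 2 + ‖g‖ ^ 2) / 2 := by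
  simpa using integral_norm_mul_conj_affine_le f g 0 0 one_ne_zero one_ne_zero

theorem integral_mul_conj (f g : L2 n) :
    ∫ t, f t * (starRingEnd ℂ) (g t) = inner ℂ g f := by
  simp only [L2.inner_def, RCLike.inner_apply]

variable {hbar : ℝ} {lam : ι → ℝ} {ψs : ι → L2 n} [Countable ι]

/-- The quadratic form of a density operator in terms of its Wigner distribution. -/
theorem integral_chordFT_mul {ρop : L2 n →L[ℂ] L2 n} (hbar_pos : 0 < hbar)
    (hρop : IsMixture ρop lam ψs) (hρm : Measurable (wignerDist hbar lam ψs))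
    (hρ : Integrable (wignerDist hbar lam ψs)) (hA : Integrable (chordFT (wignerDist hbar lam ψs)))
    (g ψ : L2 n) :
    ∫ w : Phase n, chordFT (wignerDist hbar lam ψs) w *
      ∫ s, ph (-(inner ℝ w.2 (s + hbar • w.1))) *
        ((starRingEnd ℂ) (g s) * ψ (s + (2 * hbar) • w.1))
      = ((Real.pi ^ n * |((2 * hbar) ^ n)⁻¹| : ℝ) : ℂ) * inner ℂ g (ρop ψ) := by
  obtain ⟨ho, h0, hs1, happ⟩ := hρop
  have hs := hs1.summable
  have hn : ∀ j, ‖ψs j‖ = 1 := ho.1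
  have h2 : 2 * hbar ≠ 0 := by positivity
  have hg := measurable_coe g
  have hψ := measurable_coe ψ
  set A := chordFT (wignerDist hbar lam ψs) with hAdef
  have hgψ : ∀ η : Conf n, Integrable fun s => (starRingEnd ℂ) (g s) * ψ (s + (2 * hbar) • η) := by
    intro η
    have := integrable_mul_conj_affine ψ g ((2 * hbar) • η) 0 one_ne_zero one_ne_zero
    simpa only [one_smul, zero_add, add_zero, add_comm, mul_comm] using this
  have hbound : ∀ w : Phase n, ‖∫ s, ph (-(inner ℝ w.2 (s + hbar • w.1))) *
        ((starRingEnd ℂ) (g s) * ψ (s + (2 * hbar) • w.1))‖ ≤ (‖ψ‖ ^ 2 + ‖g‖ ^ 2) / 2 := by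
    intro w
    refine (norm_integral_le_integral_norm _).trans ?_
    simp only [norm_ph_mul]
    have := integral_norm_mul_conj_affine_le ψ g ((2 * hbar) • w.1) 0 one_ne_zero one_ne_zero
    simpa [add_comm, mul_comm] using this
  have hImeas : Measurable fun w : Phase n => ∫ s, ph (-(inner ℝ w.2 (s + hbar • w.1))) *
        ((starRingEnd ℂ) (g s) * ψ (s + (2 * hbar) • w.1)) := by
    have : Measurable (Function.uncurry fun (w : Phase n) (s : Conf n) =>
        ph (-(inner ℝ w.2 (s + hbar • w.1))) *
        ((starRingEnd ℂ) (g s) * ψ (s + (2 * hbar) • w.1))) := by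
      unfold Function.uncurry
      fun_prop
    exact (this.stronglyMeasurable.integral_prod_right (ν := volume)).measurable
  have hint : Integrable (fun w : Phase n => A w * ∫ s, ph (-(inner ℝ w.2 (s + hbar • w.1))) *
        ((starRingEnd ℂ) (g s) * ψ (s + (2 * hbar) • w.1))) :=
    hA.mul_bdd hImeas.aestronglyMeasurable (Eventually.of_forall hbound)
  rw [Measure.volume_eq_prod, integral_prod _ hint]
  have hslice : ∀ᵐ η : Conf n, Integrable fun p => A (η, p) :=
    (show Integrable A (Measure.prod volume volume) from hA).prod_right_ae
  have hkernel : ∀ᵐ η : Conf n, ∀ᵐ x, mixKernel hbar lam ψs (x, -η)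
      = momFT (wignerDist hbar lam ψs) (x, -η) :=
    (Measure.measurePreserving_neg (volume : Measure (Conf n))).quasiMeasurePreserving.ae
      (mixKernel_ae_eq hbar_pos h0 hs hn hρm hρ)
  -- Integrating out `p` inverts the remaining partial transform and leaves the kernel at `(s + ħη,
  -- -η)`, whose two arguments are `s` and `s + 2ħη`.
  have hinner : ∀ᵐ η : Conf n, (∫ p : Conf n, A (η, p) * ∫ s, ph (-(inner ℝ p (s + hbar • η))) *
        ((starRingEnd ℂ) (g s) * ψ (s + (2 * hbar) • η))) = ((Real.pi ^ n : ℝ) : ℂ) *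
      ∫ s, ∑' j, (lam j : ℂ) * ((ψs j s * (starRingEnd ℂ) (g s)) *
        (ψ (s + (2 * hbar) • η) * (starRingEnd ℂ) (ψs j (s + (2 * hbar) • η)))) := by
    filter_upwards [hslice, hkernel] with η h1 h2
    simp only [← integral_const_mul]
    rw [integral_integral_swap]
    · have hinv := ae_eq_integral_cexp_neg_of_integrable (integrable_momFT_left hρm hρ (-η)) (by
        refine h1.congr (Eventually.of_forall fun p => ?_)
        change chordFT (wignerDist hbar lam ψs) (η, p) = _
        rw [chordFT_eq_integral_momFT hρ]
        rfl)
      -- The two almost everywhere identities are needed at `s + ħη`, and translation preserves null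
      -- sets.
      have tr := (measurePreserving_add_right (volume : Measure (Conf n))
        (hbar • η)).quasiMeasurePreserving
      refine integral_congr_ae ?_
      filter_upwards [tr.ae hinv, tr.ae h2] with s hs1 hs2
      have e1 : ∀ p : Conf n, A (η, p) = ∫ t : Conf n,
          Complex.exp (2 * Complex.I * ((inner ℝ t p : ℝ) : ℂ)) *
            momFT (wignerDist hbar lam ψs) (t, -η) := fun p => by
        rw [hAdef, chordFT_eq_integral_momFT hρ]; rfl
      simp only [← e1] at hs1
      have e2 : ∀ p : Conf n, A (η, p) * (ph (-(inner ℝ p (s + hbar • η))) *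
          ((starRingEnd ℂ) (g s) * ψ (s + (2 * hbar) • η)))
          = (Complex.exp (-(2 * Complex.I * ((inner ℝ (s + hbar • η) p : ℝ) : ℂ))) * A (η, p)) *
          ((starRingEnd ℂ) (g s) * ψ (s + (2 * hbar) • η)) := fun p => by
        rw [ph_neg, real_inner_comm]; ring
      simp only [e2]
      rw [integral_mul_const, ← hs1, ← hs2, mul_assoc]
      congr 1
      rw [mixKernel, ← tsum_mul_right]
      congr 1
      funext j
      simp only [mixTerm]
      rw [show s + hbar • η + hbar • -η = s by module,
        show s + hbar • η + (-hbar) • -η = s + (2 * hbar) • η by module]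
      ring
    · have := h1.mul_prod (hgψ η)
      refine (integrable_ph_mul this (c := fun q => -(inner ℝ q.1 (q.2 + hbar • η)))
        (by fun_prop)).congr (Eventually.of_forall fun q => ?_)
      simp only [Function.uncurry]
      ring
  rw [integral_congr_ae hinner, integral_const_mul]
  have hF : ∀ j, Measurable fun q : Phase n => (lam j : ℂ) * ((ψs j q.2 * (starRingEnd ℂ) (g q.2)) *
      (ψ (q.2 + (2 * hbar) • q.1) * (starRingEnd ℂ) (ψs j (q.2 + (2 * hbar) • q.1)))) := by
    intro j
    have := measurable_coe (ψs j)
    fun_prop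
  have hm₁ : ∀ j, Measurable fun t => ψs j t * (starRingEnd ℂ) (g t) := fun j => by
    have := measurable_coe (ψs j)
    fun_prop
  have hm₂ : ∀ j, Measurable fun t => ψ t * (starRingEnd ℂ) (ψs j t) := fun j => by
    have := measurable_coe (ψs j)
    fun_prop
  have hFi : ∀ j, Integrable fun q : Phase n =>
      (lam j : ℂ) * ((ψs j q.2 * (starRingEnd ℂ) (g q.2)) *
      (ψ (q.2 + (2 * hbar) • q.1) * (starRingEnd ℂ) (ψs j (q.2 + (2 * hbar) • q.1)))) := fun j =>
    (integrable_mul_shear (hm₁ j) (hm₂ j) (integrable_mul_conj _ _) (integrable_mul_conj _ _)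
      h2).const_mul _
  have hFs : Summable fun j => ∫ q : Phase n,
      ‖(lam j : ℂ) * ((ψs j q.2 * (starRingEnd ℂ) (g q.2)) *
      (ψ (q.2 + (2 * hbar) • q.1) * (starRingEnd ℂ) (ψs j (q.2 + (2 * hbar) • q.1))))‖ := by
    refine Summable.of_nonneg_of_le (fun j => integral_nonneg fun _ => norm_nonneg _) (fun j => ?_)
      (hs.mul_right (|((2 * hbar) ^ n)⁻¹| * ((1 + ‖g‖ ^ 2) / 2 * ((‖ψ‖ ^ 2 + 1) / 2))))
    simp only [norm_mul (lam j : ℂ), Complex.norm_real, Real.norm_of_nonneg (h0 j)]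
    rw [integral_const_mul, integral_norm_mul_shear (hm₁ j) (hm₂ j) (integrable_mul_conj _ _)
      (integrable_mul_conj _ _) h2]
    have b1 := integral_norm_mul_conj_le (ψs j) g
    have b2 := integral_norm_mul_conj_le ψ (ψs j)
    rw [hn, one_pow] at b1 b2
    have := h0 j
    gcongr
  have hsum := hasSum_integral_of_summable_integral_norm hFi hFs
  have htint := integrable_tsum hF hFi hFs
  rw [Measure.volume_eq_prod] at htint
  rw [Measure.volume_eq_prod, integral_prod _ htint, ← Measure.volume_eq_prod] at hsum
  have hval : ∀ j, ∫ q : Phase n, (lam j : ℂ) * ((ψs j q.2 * (starRingEnd ℂ) (g q.2)) *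
      (ψ (q.2 + (2 * hbar) • q.1) * (starRingEnd ℂ) (ψs j (q.2 + (2 * hbar) • q.1))))
      = ((|((2 * hbar) ^ n)⁻¹| : ℝ) : ℂ) *
        inner ℂ g ((lam j : ℂ) • (inner ℂ (ψs j) ψ : ℂ) • ψs j) := by
    intro j
    rw [integral_const_mul, integral_mul_shear (hm₁ j) (hm₂ j) (integrable_mul_conj _ _)
      (integrable_mul_conj _ _) h2, integral_mul_conj, integral_mul_conj, inner_smul_right,
      inner_smul_right]
    ring
  simp only [hval] at hsum
  have hsum' := (((innerSL ℂ g).hasSum (happ ψ)).mul_left ((|((2 * hbar) ^ n)⁻¹| : ℝ) : ℂ))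
  have := hsum.unique hsum'
  rw [this]
  push_cast
  simp only [innerSL_apply_apply]
  ring

/-- The Moyal product with the Wigner distribution of a density operator implements the action of
the operator. -/
theorem moyal_crossWigner {ρop : L2 n →L[ℂ] L2 n} (hbar_pos : 0 < hbar)
    (hρop : IsMixture ρop lam ψs) (hρm : Measurable (wignerDist hbar lam ψs))
    (hρ : Integrable (wignerDist hbar lam ψs)) (hA : Integrable (chordFT (wignerDist hbar lam ψs)))
    (φ ψ : L2 n) (z : Phase n) :
    (((2 * Real.pi * hbar) ^ n : ℝ) : ℂ) *
      moyal hbar (wignerDist hbar lam ψs) (crossWigner hbar ψ φ) z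
      = crossWigner hbar (ρop ψ) φ z := by
  rw [moyal_eq hbar_pos, crossWigner_eq_inner hbar_pos]
  have e : ∀ w, Complex.exp (2 * Complex.I * (sympl z w : ℂ)) * chordFT (wignerDist hbar lam ψs) w *
      crossWigner hbar ψ φ (z + hbar • w) = (((1 / (Real.pi * hbar)) ^ n : ℝ) : ℂ) *
      (chordFT (wignerDist hbar lam ψs) w * ∫ s, ph (-(inner ℝ w.2 (s + hbar • w.1))) *
        ((starRingEnd ℂ) (reflect hbar z φ s) * ψ (s + (2 * hbar) • w.1))) := fun w => by
    have := ph_sympl_mul_crossWigner hbar_pos ψ φ z w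
    rw [ph] at this
    linear_combination chordFT (wignerDist hbar lam ψs) w * this
  simp only [e]
  rw [integral_const_mul, integral_chordFT_mul hbar_pos hρop hρm hρ hA]
  simp only [← mul_assoc, ← Complex.ofReal_mul]
  congr 2
  rw [abs_of_nonneg (by positivity), pow_mul, ← inv_pow]
  simp only [← mul_pow]
  congr 1
  have := Real.pi_ne_zero
  field_simp

end MoyalMixture

/-! ### Smooth lifting of a weighted family to a Hilbert sum -/

section WeightedFamily

variable {ι H : Type*} [NormedAddCommGroup H] [InnerProductSpace ℂ H] {lam : ι → ℝ}

theorem memℓp_sqrt_smul (h0 : ∀ j, 0 ≤ lam j) (hs : Summable lam) {x : ι → H}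
    (hx : ∀ j, ‖x j‖ = 1) :
    Memℓp (fun j => ((Real.sqrt (lam j) : ℝ) : ℂ) • x j) 2 := by
  refine memℓp_gen (hs.congr fun j => ?_)
  rw [norm_smul, hx, mul_one, Complex.norm_real, Real.norm_of_nonneg (Real.sqrt_nonneg _)]
  simp [Real.sq_sqrt (h0 j)]

/-- The Hilbert sum vector with components `√λⱼ xⱼ`, where the `xⱼ` are unit vectors. -/
noncomputable def weightedVec (h0 : ∀ j, 0 ≤ lam j) (hs : Summable lam) (x : ι → H)
    (hx : ∀ j, ‖x j‖ = 1) : lp (fun _ : ι => H) 2 :=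
  ⟨fun j => ((Real.sqrt (lam j) : ℝ) : ℂ) • x j, memℓp_sqrt_smul h0 hs hx⟩

variable (h0 : ∀ j, 0 ≤ lam j) (hs : Summable lam) {x y : ι → H} (hx : ∀ j, ‖x j‖ = 1)
  (hy : ∀ j, ‖y j‖ = 1)

theorem weightedVec_apply (j : ι) :
    weightedVec h0 hs x hx j = ((Real.sqrt (lam j) : ℝ) : ℂ) • x j := rfl

theorem inner_sqrt_smul {l : ℝ} (hl : 0 ≤ l) (a b : H) :
    inner ℂ (((Real.sqrt l : ℝ) : ℂ) • a) (((Real.sqrt l : ℝ) : ℂ) • b)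
      = (l : ℂ) * inner ℂ a b := by
  rw [inner_smul_left, inner_smul_right, Complex.conj_ofReal, ← mul_assoc, ← Complex.ofReal_mul,
    Real.mul_self_sqrt hl]

theorem hasSum_inner_weightedVec :
    HasSum (fun j => (lam j : ℂ) * inner ℂ (x j) (y j))
      (inner ℂ (weightedVec h0 hs x hx) (weightedVec h0 hs y hy)) := by
  refine (lp.hasSum_inner (𝕜 := ℂ) (weightedVec h0 hs x hx) (weightedVec h0 hs y hy)).congr_fun
    fun j => ?_
  rw [weightedVec_apply, weightedVec_apply, inner_sqrt_smul (h0 j)]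

/-- A family of Hilbert space valued functions with smooth weighted Gram kernel is the family of
components of a smooth function. -/
theorem exists_contDiff_lift [CompleteSpace H] {E : Type*} [NormedAddCommGroup E] [NormedSpace ℝ E]
    [FiniteDimensional ℝ E] (h0 : ∀ j, 0 ≤ lam j) (hs : Summable lam) (hx : ∀ j, ‖x j‖ = 1)
    {R : E → ι → H} (hR : ∀ z j, ‖R z j‖ = 1) {K : E × E → ℂ}
    (hK : ContDiff ℝ ∞ K)
    (hsum : ∀ z z', HasSum (fun j => (lam j : ℂ) * inner ℂ (R z j) (R z' j)) (K (z, z'))) (c : ℂ) :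
    ∃ (h : E → lp (fun _ : ι => H) 2) (Λ : ι → lp (fun _ : ι => H) 2 →L[ℂ] ℂ)
      (Λ₀ : lp (fun _ : ι => H) 2 →L[ℂ] ℂ), ContDiff ℝ ∞ h ∧
      (∀ j z, Λ j (h z) = (lam j : ℂ) * (c * inner ℂ (x j) (R z j))) ∧
      (∀ v, HasSum (fun j => Λ j v) (Λ₀ v)) := by
  classical
  -- `Λ₀` pairs with the whole vector `(√λⱼ xⱼ)ⱼ` and `Λ j` with its `j`-th component, so `∑ⱼ Λ j v
  -- = Λ₀ v` is the series of the inner product. The square roots on both sides multiply to `λⱼ`.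
  refine ⟨fun z => weightedVec h0 hs (R z) (hR z),
    fun j => c • innerSL ℂ (lp.single 2 j (weightedVec h0 hs x hx j)),
    c • innerSL ℂ (weightedVec h0 hs x hx), ?_, ?_, ?_⟩
  · refine contDiff_of_gram ?_
    have key : ∀ w : E × E, (inner ℂ (weightedVec h0 hs (R w.1) (hR w.1))
        (weightedVec h0 hs (R w.2) (hR w.2)) : ℂ) = K w := fun w =>
      (hasSum_inner_weightedVec h0 hs (hR w.1) (hR w.2)).unique (hsum w.1 w.2)
    simpa only [key] using hK
  · intro j z
    rw [smul_apply, innerSL_apply_apply, lp.inner_single_left, weightedVec_apply,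
      weightedVec_apply, inner_sqrt_smul (h0 j), smul_eq_mul]
    ring
  · intro v
    simp only [smul_apply, innerSL_apply_apply, lp.inner_single_left]
    exact (lp.hasSum_inner (weightedVec h0 hs x hx) v).const_smul c

end WeightedFamily

/-! ### Smoothness of the components and termwise Poisson powers -/

section Coefficients

variable {n : ℕ} {ι : Type*} {hbar : ℝ} {lam : ι → ℝ} {ψs : ι → L2 n}

/-- The Wigner distributions of a mixture and of its components are linear images of one smooth
Hilbert space valued function. -/
theorem exists_contDiff_lift_crossWigner [Countable ι] (hbar_pos : 0 < hbar) (h0 : ∀ j, 0 ≤ lam j)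
    (hs : Summable lam) (hn : ∀ j, ‖ψs j‖ = 1) (f : SchwartzMap (Phase n) ℂ)
    (hf : ⇑f = wignerDist hbar lam ψs) :
    ∃ (h : Phase n → lp (fun _ : ι => L2 n) 2) (Λ : ι → lp (fun _ : ι => L2 n) 2 →L[ℂ] ℂ)
      (Λ₀ : lp (fun _ : ι => L2 n) 2 →L[ℂ] ℂ), ContDiff ℝ ∞ h ∧
      (∀ j z, Λ j (h z) = (lam j : ℂ) * crossWigner hbar (ψs j) (ψs j) z) ∧
      (∀ v, HasSum (fun j => Λ j v) (Λ₀ v)) := by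
  have hA : chordFT (wignerDist hbar lam ψs) = chordS f := by
    funext w; rw [chordS_apply, hf]
  -- The reflected vector has to stand in the second, complex linear slot, so that the transform is
  -- a linear functional of the lift.
  simp only [crossWigner_eq_inner' hbar_pos]
  refine exists_contDiff_lift h0 hs hn (R := fun z j => reflect hbar z (ψs j))
    (fun z j => by rw [norm_reflect, hn])
    (K := fun w => ph (sympl w.2 w.1 / hbar) * chordS f (hbar⁻¹ • (w.1 - w.2))) ?_ ?_ _
  · refine (contDiff_ph.comp ((contDiff_sympl contDiff_snd contDiff_fst).div_const _)).mul ?_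
    exact ((chordS f).smooth ⊤).comp ((contDiff_fst.sub contDiff_snd).const_smul hbar⁻¹)
  · intro z z'
    have := hasSum_inner_reflect hbar_pos h0 hs hn (hf ▸ f.continuous.measurable)
      (hf ▸ f.integrable) (hA ▸ (chordS f).continuous) z z'
    rwa [hA] at this

theorem contDiff_crossWigner_of_schwartz [Countable ι] (hbar_pos : 0 < hbar) (h0 : ∀ j, 0 ≤ lam j)
    (hs : Summable lam) (hn : ∀ j, ‖ψs j‖ = 1) (f : SchwartzMap (Phase n) ℂ)
    (hf : ⇑f = wignerDist hbar lam ψs) (j : ι) (hj : lam j ≠ 0) :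
    ContDiff ℝ ∞ (crossWigner hbar (ψs j) (ψs j)) := by
  obtain ⟨h, Λ, Λ₀, hh, hΛ, -⟩ := exists_contDiff_lift_crossWigner hbar_pos h0 hs hn f hf
  have e : crossWigner hbar (ψs j) (ψs j) = fun z => (lam j : ℂ)⁻¹ * Λ j (h z) := by
    funext z
    rw [hΛ, inv_mul_cancel_left₀ (by exact_mod_cast hj)]
  rw [e]
  exact contDiff_const.mul (((Λ j).restrictScalars ℝ).contDiff.comp hh)

/-- One vector `v` computes the Poisson power for all functionals of the lift at once, so the claim
is `∑ⱼ Λⱼ v = Λ₀ v`. Positivity of the weights permits recovering each component by dividing by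
`λⱼ`. -/
theorem hasSum_poissonPow_crossWigner [Countable ι] (hbar_pos : 0 < hbar) (h0 : ∀ j, 0 < lam j)
    (hs : Summable lam) (hn : ∀ j, ‖ψs j‖ = 1) (f : SchwartzMap (Phase n) ℂ)
    (hf : ⇑f = wignerDist hbar lam ψs) {b : Phase n → ℂ} (hb : ContDiff ℝ ∞ b) (r : ℕ)
    (z : Phase n) :
    HasSum (fun j => (lam j : ℂ) * poissonPow r (crossWigner hbar (ψs j) (ψs j)) b z)
      (poissonPow r (wignerDist hbar lam ψs) b z) := by
  obtain ⟨h, Λ, Λ₀, hh, hΛ, hΛ₀⟩ :=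
    exists_contDiff_lift_crossWigner hbar_pos (fun j => (h0 j).le) hs hn f hf
  obtain ⟨v, hv⟩ := exists_poissonPow_clm hh hb r z
  have e₀ : wignerDist hbar lam ψs = fun z => Λ₀ (h z) := by
    funext z
    rw [← (hΛ₀ (h z)).tsum_eq, wignerDist]
    simp only [hΛ]
  have e : ∀ j, (lam j : ℂ) * poissonPow r (crossWigner hbar (ψs j) (ψs j)) b z = Λ j v := by
    intro j
    have hj : (lam j : ℂ) ≠ 0 := by exact_mod_cast (h0 j).ne'
    have e' : crossWigner hbar (ψs j) (ψs j) = fun z => ((lam j : ℂ)⁻¹ • Λ j) (h z) := by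
      funext z
      rw [smul_apply, hΛ, smul_eq_mul, inv_mul_cancel_left₀ hj]
    rw [e', hv, smul_apply, smul_eq_mul, mul_inv_cancel_left₀ hj]
  rw [e₀, hv]
  simpa only [e] using hΛ₀ v

end Coefficients

/-! ### Reduction to the indices of nonzero weight -/

section Support

variable {n : ℕ} {ι : Type*} {hbar : ℝ} {lam : ι → ℝ} {ψs : ι → L2 n}

theorem wignerDist_support (hbar : ℝ) (lam : ι → ℝ) (ψs : ι → L2 n) :
    wignerDist hbar (fun j : {j // lam j ≠ 0} => lam j) (fun j => ψs j)
      = wignerDist hbar lam ψs := by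
  funext z
  refine tsum_subtype_eq_of_support_subset (s := {j | lam j ≠ 0})
    (f := fun j => (lam j : ℂ) * crossWigner hbar (ψs j) (ψs j) z) fun j hj hj' => hj ?_
  simp [hj']

/-- Discarding zero weights makes the index set countable, as the measurability of the kernel
requires, and the weights strictly positive. -/
theorem IsMixture.support {ρop : L2 n →L[ℂ] L2 n} (h : IsMixture ρop lam ψs) :
    IsMixture ρop (fun j : {j // lam j ≠ 0} => lam j) (fun j => ψs j) where
  orthonormal := h.orthonormal.comp _ Subtype.val_injective
  nonneg j := h.nonneg j
  hasSum_one := (hasSum_subtype_iff_of_support_subset (s := {j | lam j ≠ 0}) (f := lam)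
    fun _ hj => hj).2 h.hasSum_one
  hasSum_apply f := (hasSum_subtype_iff_of_support_subset (s := {j | lam j ≠ 0})
    (f := fun j => (lam j : ℂ) • (inner ℂ (ψs j) f : ℂ) • ψs j)
    fun j hj hj' => hj (by simp [hj'])).2 (h.hasSum_apply f)

end Support

theorem boppDensity_wavepacket {n : ℕ} {hbar : ℝ} (hbar_pos : 0 < hbar) (ρ : Phase n → ℂ)
    (φ ψ : L2 n) (z : Phase n) :
    boppDensity hbar ρ φ ⟨wavepacket hbar φ ψ, Set.mem_range_self ψ⟩ z
      = (((2 * Real.pi * hbar) ^ ((n : ℝ) / 2) : ℝ) : ℂ) * ((((2 * Real.pi * hbar) ^ n : ℝ) : ℂ) *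
        moyal hbar ρ (crossWigner hbar ψ φ) z) := by
  rw [boppDensity, boppOp_eq hbar_pos]
  simp only [moyal, wavepacket]
  rw [mul_left_comm _ (((1 / (Real.pi * hbar)) ^ (2 * n) : ℝ) : ℂ),
    mul_left_comm _ (((1 / (Real.pi * hbar)) ^ (2 * n) : ℝ) : ℂ)]
  simp only [← integral_const_mul]
  congr! 5
  ring

end BoppMoyal

theorem mainTheorem2 (n : ℕ) (hbar : ℝ) (hbar_pos : 0 < hbar) {ι : Type*}
    (ρop : L2 n →L[ℂ] L2 n) (lam : ι → ℝ) (ψs : ι → L2 n) (hρop : IsMixture ρop lam ψs)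
    (hρ : ∃ f : SchwartzMap (Phase n) ℂ, ∀ z, f z = wignerDist hbar lam ψs z)
    (φ ψ : L2 n) (hW : ContDiff ℝ ∞ (crossWigner hbar ψ φ)) :
    -- the operator acts on the space of wavepacket transforms as the density operator does
    boppDensity hbar (wignerDist hbar lam ψs) φ ⟨wavepacket hbar φ ψ, Set.mem_range_self ψ⟩
        = wavepacket hbar φ (ρop ψ) ∧
    -- its value is a multiple of the Moyal product, at the value `hbar` of the parameter
    (∀ z, boppDensity hbar (wignerDist hbar lam ψs) φ
          ⟨wavepacket hbar φ ψ, Set.mem_range_self ψ⟩ z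
        = (((2 * Real.pi * hbar) ^ (3 * (n : ℝ) / 2) : ℝ) : ℂ) *
            moyal hbar (wignerDist hbar lam ψs) (crossWigner hbar ψ φ) z) ∧
    -- the Moyal product is identified with the formal series
    HasFormalSeries (fun ε => moyal ε (wignerDist hbar lam ψs) (crossWigner hbar ψ φ))
      (moyalSeries (wignerDist hbar lam ψs) (crossWigner hbar ψ φ)) ∧
    -- the coefficients of the formal series
    (∀ j, lam j ≠ 0 → ContDiff ℝ ∞ (crossWigner hbar (ψs j) (ψs j))) ∧
    (∀ (r : ℕ) (z : Phase n),
      HasSum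
        (fun j => (lam j : ℂ) *
          poissonPow r (crossWigner hbar (ψs j) (ψs j)) (crossWigner hbar ψ φ) z)
        (poissonPow r (wignerDist hbar lam ψs) (crossWigner hbar ψ φ) z)) := by
  obtain ⟨f, hf'⟩ := hρ
  have hf : ⇑f = wignerDist hbar lam ψs := funext hf'
  have hA : chordFT (wignerDist hbar lam ψs) = chordS f := by
    funext w; rw [chordS_apply, hf]
  have hfs : ⇑f = wignerDist hbar (fun j : {j // lam j ≠ 0} => lam j) (fun j => ψs j) := by
    rw [wignerDist_support, hf]
  have hmix := hρop.support
  have hs := hmix.hasSum_one.summable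
  -- The index type is arbitrary, but a summable real family has countable support.
  have : Countable {j // lam j ≠ 0} := hρop.hasSum_one.summable.countable_support
  have hmoyal : ∀ z, (((2 * Real.pi * hbar) ^ n : ℝ) : ℂ) *
      moyal hbar (wignerDist hbar lam ψs) (crossWigner hbar ψ φ) z
      = crossWigner hbar (ρop ψ) φ z := fun z => by
    have := moyal_crossWigner hbar_pos hmix (hfs ▸ f.continuous.measurable) (hfs ▸ f.integrable)
      (by rw [wignerDist_support, hA]; exact (chordS f).integrable) φ ψ z
    rwa [wignerDist_support] at this
  refine ⟨?_, ?_, ?_, ?_, ?_⟩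
  · funext z
    rw [boppDensity_wavepacket hbar_pos, hmoyal, wavepacket]
  · intro z
    have h2 : 0 < 2 * Real.pi * hbar := by positivity
    -- The exponent is `3n/2 = n/2 + n`: the first part normalizes the wavepacket transform, the
    -- second the Bopp symbol.
    rw [boppDensity_wavepacket hbar_pos, ← mul_assoc, ← Complex.ofReal_mul, ← Real.rpow_natCast,
      ← Real.rpow_add h2]
    congr 4
    ring
  · rw [← hf]
    exact hasFormalSeries_moyal f hW (norm_crossWigner_le hbar_pos ψ φ)
  · exact fun j hj => contDiff_crossWigner_of_schwartz hbar_pos hmix.nonneg hs hmix.orthonormal.1 f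
      hfs ⟨j, hj⟩ hj
  · intro r z
    have := hasSum_poissonPow_crossWigner hbar_pos
      (fun j => lt_of_le_of_ne (hmix.nonneg j) j.2.symm) hs hmix.orthonormal.1 f hfs hW r z
    rw [wignerDist_support] at this
    exact (hasSum_subtype_iff_of_support_subset (s := {j | lam j ≠ 0})
      (f := fun j => (lam j : ℂ) * poissonPow r (crossWigner hbar (ψs j) (ψs j))
        (crossWigner hbar ψ φ) z) fun j hj hj' => hj (by simp [hj'])).1 this
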